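/- Let $A,E$ be real $n\times n$ matrices, let $\theta_1,\theta_2\in(-\pi,\pi)$, and write $j=\sqrt{-1}$. Let $\alpha,\beta\in\mathbb C$ be such that $W:=\alpha E+\beta A$ is invertible. Let $[\theta_1,\theta_2]$ denote the closed interval with endpoints $\theta_1$ and $\theta_2$ (in either order). Assume that $\det(A-e^{j\phi}E)\neq 0$ for every real $\phi$ with $\arg(e^{j\phi})\in[\theta_1,\theta_2]$, where $\arg$ takes values in $(-\pi,\pi]$. The principal logarithm $\log M$ of a complex square matrix $M$ without eigenvalues on the closed negative real axis is the unique matrix $Q$ with $e^Q=M$ all of whose eigenvalues lie in $\{-\pi<\operatorname{Im} z<\pi\}$. For scalars, $\log$ is the principal logarithm. For $\varepsilon\in\mathbb C$ put $A_\varepsilon=A+\alpha\varepsilon I$, $E_\varepsilon=E-\beta\varepsilon I$, $$\Gamma(\theta,\varepsilon)=(E_\varepsilon+A_\varepsilon)\tan\tfrac{\theta}{2}-j(E_\varepsilon-A_\varepsilon),\qquad \eta=\log\frac{\tan(\theta_2/2)-j}{\tan(\theta_1/2)-j},$$ $$Y_\varepsilon=-\eta I+\log\big(\Gamma(\theta_2,\varepsilon)\Gamma(\theta_1,\varepsilon)^{-1}\big),\qquad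 Y=-\eta I+\log\big(\Gamma(\theta_2,0)\Gamma(\theta_1,0)^{-1}\big),$$ and $\psi_1(X)=\sum_{k=0}^\infty \frac{X^k}{(k+1)!}$. Then: 1. For $\varepsilon=0$ and for all sufficiently small $\varepsilon\ne0$, the matrix $\Gamma(\theta_1,\varepsilon)$ is invertible and $\Gamma(\theta_2,\varepsilon)\Gamma(\theta_1,\varepsilon)^{-1}$ has no eigenvalue on the closed negative real axis and has a unique principal logarithm, so that $Y_\varepsilon$ and $Y$ are well defined. Moreover $Y=\lim_{\varepsilon\to0}Y_\varepsilon$. 2. The matrix $\psi_1(Y)$ is invertible. Put $L:=\psi_1(Y)^{-1}$. If $\theta_1\neq\theta_2$, then $e^{Y_\varepsilon}-I$ is invertible for all sufficiently small $\varepsilon\neq0$, and $L=\lim_{\varepsilon\to0}(e^{Y_\varepsilon}-I)^{-1}Y_\varepsilon$. 3. The matrix $e^{j\theta}E-A$ is invertible for every $\theta\in[\theta_1,\theta_2]$, its inverse is integrable in $\theta$ over this interval, and $$\int_{\theta_1}^{\theta_2}(e^{j\theta}E-A)^{-1}\,d\theta=\frac1j\,W^{-1}\Big(-\alpha L\big(e^{-j\theta_2}I-e^{-j\theta_1}e^{Y}\big)+\beta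 Y\Big).$$ -/

import Mathlib

open Filter Topology

noncomputable section

namespace DescriptorIntegral

/-- The wrapped angle: the principal argument, in `(-π, π]`, of `e^{jθ}`. -/
def wrap (θ : ℝ) : ℝ :=
  Complex.arg (Complex.exp (Complex.I * (θ : ℂ)))

/-- A real matrix regarded as a complex matrix. -/
def toComplex {n : ℕ} (A : Matrix (Fin n) (Fin n) ℝ) : Matrix (Fin n) (Fin n) ℂ :=
  A.map Complex.ofReal

/-- `z` is an eigenvalue of the matrix pencil `(A, E)`, i.e. `det (A - z E) = 0`. -/
def IsPencilEigenvalue {n : ℕ} (A E : Matrix (Fin n) (Fin n) ℝ) (z : ℂ) : Prop :=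
  (toComplex A - z • toComplex E).det = 0

/-- `W = α E + β A`. -/
def pencilW {n : ℕ} (A E : Matrix (Fin n) (Fin n) ℝ) (α β : ℂ) : Matrix (Fin n) (Fin n) ℂ :=
  α • toComplex E + β • toComplex A

/-- The matrix `e^{jθ} E - A`, whose inverse is the transfer function at `e^{jθ}`. -/
def pencilAt {n : ℕ} (A E : Matrix (Fin n) (Fin n) ℝ) (θ : ℝ) : Matrix (Fin n) (Fin n) ℂ :=
  Complex.exp (Complex.I * (θ : ℂ)) • toComplex E - toComplex A

/-- `Q` is a logarithm of `M` all of whose eigenvalues lie in the open strip `-π < Im z < π`. -/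
def IsPrincipalLog {n : ℕ} (M Q : Matrix (Fin n) (Fin n) ℂ) : Prop :=
  NormedSpace.exp Q = M ∧
    ∀ z ∈ spectrum ℂ Q, -Real.pi < z.im ∧ z.im < Real.pi

open Classical in
/-- The principal logarithm of a complex matrix (the value is `0` if there is none). -/
def matrixLog {n : ℕ} (M : Matrix (Fin n) (Fin n) ℂ) : Matrix (Fin n) (Fin n) ℂ :=
  if h : ∃ Q, IsPrincipalLog M Q then h.choose else 0

/-- The principal logarithm of `M` is well defined: no eigenvalue of `M` lies on the closed
negative real axis, and there is exactly one principal logarithm. -/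
def HasPrincipalLog {n : ℕ} (M : Matrix (Fin n) (Fin n) ℂ) : Prop :=
  (∀ z ∈ spectrum ℂ M, z ∈ Complex.slitPlane) ∧ ∃! Q, IsPrincipalLog M Q

/-- `ψ₁(X) = ∑_{j ≥ 0} X^j / (j + 1)!`; the series converges for every square matrix. -/
def psi1 {n : ℕ} (X : Matrix (Fin n) (Fin n) ℂ) : Matrix (Fin n) (Fin n) ℂ :=
  ∑' j : ℕ, (((j + 1).factorial : ℂ)⁻¹) • X ^ j

/-- `A_ε = A + α ε I`. -/
def perturbA {n : ℕ} (A : Matrix (Fin n) (Fin n) ℝ) (α ε : ℂ) : Matrix (Fin n) (Fin n) ℂ :=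
  toComplex A + (α * ε) • 1

/-- `E_ε = E - β ε I`. -/
def perturbE {n : ℕ} (E : Matrix (Fin n) (Fin n) ℝ) (β ε : ℂ) : Matrix (Fin n) (Fin n) ℂ :=
  toComplex E - (β * ε) • 1

/-- `Γ(θ, ε) = (E_ε + A_ε) tan(θ/2) - j (E_ε - A_ε)`. -/
def pencilGamma {n : ℕ} (A E : Matrix (Fin n) (Fin n) ℝ) (α β : ℂ) (θ : ℝ) (ε : ℂ) :
    Matrix (Fin n) (Fin n) ℂ :=
  (Real.tan (θ / 2) : ℂ) • (perturbE E β ε + perturbA A α ε)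
    - Complex.I • (perturbE E β ε - perturbA A α ε)

/-- `Γ(θ₂, ε) Γ(θ₁, ε)⁻¹`. -/
def gammaQuot {n : ℕ} (A E : Matrix (Fin n) (Fin n) ℝ) (α β : ℂ) (θ₁ θ₂ : ℝ) (ε : ℂ) :
    Matrix (Fin n) (Fin n) ℂ :=
  pencilGamma A E α β θ₂ ε * (pencilGamma A E α β θ₁ ε)⁻¹

/-- `η = log ((tan(θ₂/2) - j) / (tan(θ₁/2) - j))`. -/
def eta (θ₁ θ₂ : ℝ) : ℂ :=
  Complex.log (((Real.tan (θ₂ / 2) : ℂ) - Complex.I) / ((Real.tan (θ₁ / 2) : ℂ) - Complex.I))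

/-- `Y_ε = -η I + log (Γ(θ₂, ε) Γ(θ₁, ε)⁻¹)`; its value at `ε = 0` is `Y`. -/
def matrixY {n : ℕ} (A E : Matrix (Fin n) (Fin n) ℝ) (α β : ℂ) (θ₁ θ₂ : ℝ) (ε : ℂ) :
    Matrix (Fin n) (Fin n) ℂ :=
  -(eta θ₁ θ₂ • (1 : Matrix (Fin n) (Fin n) ℂ)) + matrixLog (gammaQuot A E α β θ₁ θ₂ ε)

/-- The entrywise integral of a matrix-valued function over the oriented interval `θ₁..θ₂`. -/
def matrixIntegral {n : ℕ} (F : ℝ → Matrix (Fin n) (Fin n) ℂ) (θ₁ θ₂ : ℝ) :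
    Matrix (Fin n) (Fin n) ℂ :=
  Matrix.of fun i k => ∫ θ in θ₁..θ₂, F θ i k

end DescriptorIntegral

end

noncomputable section

namespace DescriptorIntegral

/-! ### Exponentials, the series `psiSeries`, and an integral logarithm in a Banach algebra. -/

section BanachAlgebra

/-! Write R(θ) = e^{jθ}E - A and J = ∫ R(θ)⁻¹ dθ. Up to a nonzero scalar Γ(θ) is R(θ), and Γ is
affine in t = tan(θ/2). Hence, for M = Γ(θ₂)Γ(θ₁)⁻¹, the segment from I to M consists of the
invertible matrices Γ(t)Γ(t₁)⁻¹. So M has no eigenvalue on (-∞, 0], and log M = ∫₀¹ (M - 1)(1 + s(M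
- 1))⁻¹ ds. Substituting t, then θ, and subtracting the scalar case A = 0, E = 1, which is η, gives
Y = jAJ (`pencilY_eq`). The same formula makes Y_ε continuous at ε = 0, so no continuity of the
matrix logarithm is needed.

The companion identity is ψ₁(Y)·jEJ = e^{-jθ₁}e^Y - e^{-jθ₂}I. For invertible A it follows from
ψ₁(Y)Y = e^Y - I, because jEJ = EA⁻¹Y and EA⁻¹ commutes with Y (`psi1_pencilY_mul_of_isUnit`). For
singular A it is the limit of the identities for A_ε, which is invertible for small ε ≠ 0 because W
is invertible (`psi1_matrixY_mul`). Then WJ = αEJ + βAJ gives the closed form.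

Eigenvalues of Y have imaginary part in (-2π, 2π), where ψ₁ has no zero, so ψ₁(Y) is invertible. The
same fact gives uniqueness of the principal logarithm. -/

/-- The factor ‖1‖ is kept because ‖1‖ = 1 fails for matrices of size 0. -/
theorem norm_pow_le_norm_one_mul {R : Type*} [NormedRing R] (x : R) (j : ℕ) :
    ‖x ^ j‖ ≤ ‖(1 : R)‖ * ‖x‖ ^ j := by
  induction j with
  | zero => simp
  | succ j ih =>
    rw [pow_succ, pow_succ, ← mul_assoc]
    exact (norm_mul_le _ _).trans (by gcongr)

variable {𝔸 : Type*} [NormedRing 𝔸] [NormedAlgebra ℂ 𝔸]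

/-- The series `∑ X ^ j / (j + 1)!` in a complex Banach algebra. -/
def psiSeries (x : 𝔸) : 𝔸 := ∑' j : ℕ, (((j + 1).factorial : ℂ)⁻¹) • x ^ j

theorem psiSeries_term_norm_le {x : 𝔸} {r : ℝ} (hx : ‖x‖ ≤ r) (j : ℕ) :
    ‖(((j + 1).factorial : ℂ)⁻¹) • x ^ j‖ ≤ ‖(1 : 𝔸)‖ * (r ^ j / j.factorial) := by
  have h := inv_anti₀ (by positivity)
    (show (j.factorial : ℝ) ≤ (j + 1).factorial by exact_mod_cast Nat.factorial_le j.le_succ)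
  calc _ ≤ (j.factorial : ℝ)⁻¹ * (‖(1 : 𝔸)‖ * r ^ j) := by
        rw [norm_smul, norm_inv, Complex.norm_natCast]
        gcongr
        exact (norm_pow_le_norm_one_mul x j).trans (by gcongr)
    _ = _ := by rw [div_eq_mul_inv]; ring

variable [CompleteSpace 𝔸]

theorem psiSeries_summable (x : 𝔸) :
    Summable fun j : ℕ => (((j + 1).factorial : ℂ)⁻¹) • x ^ j :=
  Summable.of_norm_bounded ((Real.summable_pow_div_factorial ‖x‖).mul_left _)
    (psiSeries_term_norm_le le_rfl)

theorem psiSeries_hasSum (x : 𝔸) :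
    HasSum (fun j : ℕ => (((j + 1).factorial : ℂ)⁻¹) • x ^ j) (psiSeries x) :=
  (psiSeries_summable x).hasSum

theorem psiSeries_mul_self (x : 𝔸) : psiSeries x * x = NormedSpace.exp x - 1 := by
  have h1 := (psiSeries_hasSum x).mul_right x
  have h2 := NormedSpace.exp_series_hasSum_exp' (𝕂 := ℂ) x
  rw [← hasSum_nat_add_iff' 1] at h2
  simp only [Finset.range_one, Finset.sum_singleton, Nat.factorial_zero, Nat.cast_one, inv_one,
    pow_zero, one_smul] at h2
  refine h1.unique ?_
  simpa only [smul_mul_assoc, ← pow_succ] using h2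

theorem continuous_psiSeries : Continuous (psiSeries : 𝔸 → 𝔸) := by
  rw [continuous_iff_continuousAt]
  intro x
  have h : ContinuousOn (psiSeries : 𝔸 → 𝔸) (Metric.ball 0 (‖x‖ + 1)) := by
    refine continuousOn_tsum (fun j => by fun_prop)
      ((Real.summable_pow_div_factorial (‖x‖ + 1)).mul_left ‖(1 : 𝔸)‖) fun j y hy => ?_
    exact psiSeries_term_norm_le (mem_ball_zero_iff.mp hy).le j
  exact h.continuousAt (Metric.isOpen_ball.mem_nhds (by simp))

theorem commute_psiSeries {x y : 𝔸} (h : Commute y x) : Commute y (psiSeries x) := by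
  have h1 := (psiSeries_hasSum x).mul_left y
  have h2 := (psiSeries_hasSum x).mul_right y
  refine h1.unique ?_
  simpa only [mul_smul_comm, smul_mul_assoc, (h.pow_right _).eq] using h2

theorem exp_add_of_commute' {x y : 𝔸} (h : Commute x y) :
    NormedSpace.exp (x + y) = NormedSpace.exp x * NormedSpace.exp y :=
  let _ := NormedAlgebra.restrictScalars ℚ ℂ 𝔸
  NormedSpace.exp_add_of_commute h

theorem exp_neg_mul_exp (x : 𝔸) : NormedSpace.exp (-x) * NormedSpace.exp x = 1 := by
  rw [← exp_add_of_commute' (Commute.neg_left (Commute.refl x)), neg_add_cancel,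
    NormedSpace.exp_zero]

/-- The chain rule for the exponential of a path whose values commute with one of them. -/
theorem hasDerivWithinAt_exp_of_commute {f : ℝ → 𝔸} {f' : 𝔸} {s : ℝ} {S : Set ℝ}
    (hf : HasDerivWithinAt f f' S s) (hc : ∀ᶠ t in 𝓝[S] s, Commute (f s) (f t)) :
    HasDerivWithinAt (fun t => NormedSpace.exp (f t)) (NormedSpace.exp (f s) * f') S s := by
  -- Commutation gives exp (f t) = exp (f s) exp (f t - f s), so only the derivative of exp at 0 is
  -- needed.
  have h0 : HasFDerivAt (NormedSpace.exp : 𝔸 → 𝔸) (1 : 𝔸 →L[ℝ] 𝔸) (f s - f s) := by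
    rw [sub_self]; exact hasFDerivAt_exp_zero
  have h1 : HasDerivWithinAt (fun t => NormedSpace.exp (f t - f s)) f' S s := by
    simpa using! h0.comp_hasDerivWithinAt s (hf.sub_const (f s))
  refine (h1.const_mul (NormedSpace.exp (f s))).congr_of_eventuallyEq ?_ (by simp)
  filter_upwards [hc] with t ht
  rw [← exp_add_of_commute' (ht.sub_right (Commute.refl _)), add_sub_cancel]

theorem map_intervalIntegral {E F : Type*} [NormedAddCommGroup E] [NormedSpace ℂ E]
    [CompleteSpace E] [NormedAddCommGroup F] [NormedSpace ℂ F] [CompleteSpace F] (φ : E →L[ℂ] F)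
    {f : ℝ → E} {a b : ℝ} (hf : ContinuousOn f (Set.uIcc a b)) :
    ∫ t in a..b, φ (f t) = φ (∫ t in a..b, f t) :=
  φ.intervalIntegral_comp_comm hf.intervalIntegrable

theorem commute_intervalIntegral {f : ℝ → 𝔸} {a b : ℝ} {c : 𝔸}
    (hf : ContinuousOn f (Set.uIcc a b))
    (h : ∀ t ∈ Set.uIcc a b, Commute c (f t)) : Commute c (∫ t in a..b, f t) := by
  replace hf := hf.intervalIntegrable (μ := MeasureTheory.volume)
  have h1 := (ContinuousLinearMap.mul ℝ 𝔸 c).intervalIntegral_comp_comm hf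
  have h2 := ((ContinuousLinearMap.mul ℝ 𝔸).flip c).intervalIntegral_comp_comm hf
  simp only [ContinuousLinearMap.flip_apply, ContinuousLinearMap.mul_apply'] at h1 h2
  rw [Commute, SemiconjBy, ← h1, ← h2]
  exact intervalIntegral.integral_congr fun t ht => (h t ht).eq

/-- The exponential of `∫₀¹ k (1 + s k)⁻¹ ds` is `1 + k`. -/
theorem exp_integral_eq_one_add {k : 𝔸} {f : ℝ → 𝔸} (hf : ContinuousOn f (Set.Icc 0 1))
    (hinv : ∀ s ∈ Set.Icc (0 : ℝ) 1, f s * (1 + (s : ℂ) • k) = 1)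
    (hk : ∀ s ∈ Set.Icc (0 : ℝ) 1, Commute k (f s))
    (hc : ∀ s ∈ Set.Icc (0 : ℝ) 1, ∀ t ∈ Set.Icc (0 : ℝ) 1, Commute (f s) (f t)) :
    NormedSpace.exp (∫ s in (0 : ℝ)..1, k * f s) = 1 + k := by
  simp only [Complex.coe_smul] at hinv
  set g : ℝ → 𝔸 := fun s => k * f s with hg
  have hgc : ContinuousOn g (Set.Icc 0 1) := continuousOn_const.mul hf
  have hII : ∀ s ∈ Set.Icc (0 : ℝ) 1, Set.uIcc 0 s ⊆ Set.Icc 0 1 := fun s hs =>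
    Set.uIcc_of_le hs.1 ▸ Set.Icc_subset_Icc_right hs.2
  have hint : ∀ s ∈ Set.Icc (0 : ℝ) 1, ContinuousOn g (Set.uIcc 0 s) :=
    fun s hs => hgc.mono (hII s hs)
  have hgg : ∀ s ∈ Set.Icc (0 : ℝ) 1, ∀ t ∈ Set.Icc (0 : ℝ) 1, Commute (g s) (g t) :=
    fun s hs t ht => (((Commute.refl k).mul_right (hk t ht)).mul_left
      ((hk s hs).symm.mul_right (hc s hs t ht)))
  set F : ℝ → 𝔸 := fun s => ∫ u in (0 : ℝ)..s, g u with hF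
  have hFF : ∀ s ∈ Set.Icc (0 : ℝ) 1, ∀ t ∈ Set.Icc (0 : ℝ) 1, Commute (F s) (F t) :=
    fun s hs t ht => commute_intervalIntegral (hint t ht) fun u hu =>
      (commute_intervalIntegral (hint s hs) fun v hv =>
        hgg u (hII t ht hu) v (hII s hs hv)).symm
  have hFd : ∀ s ∈ Set.Ico (0 : ℝ) 1, HasDerivWithinAt F (g s) (Set.Ici s) s := fun s hs =>
    intervalIntegral.integral_hasDerivWithinAt_right (t := Set.Ioi s)
      (hint s (Set.Ico_subset_Icc_self hs)).intervalIntegrable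
      ⟨Set.Icc s 1, Icc_mem_nhdsGT hs.2,
        (hgc.mono (Set.Icc_subset_Icc_left hs.1)).aestronglyMeasurable measurableSet_Icc⟩
      ((hgc s (Set.Ico_subset_Icc_self hs)).mono_of_mem_nhdsWithin
        (mem_of_superset (Icc_mem_nhdsGT hs.2) (Set.Icc_subset_Icc_left hs.1)))
  have hFc : ContinuousOn F (Set.Icc 0 1) := by
    have := intervalIntegral.continuousOn_primitive_interval (a := (0 : ℝ)) (b := 1)
      (μ := MeasureTheory.volume) (f := g)
      (by rw [Set.uIcc_of_le zero_le_one]; exact hgc.integrableOn_Icc)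
    rwa [Set.uIcc_of_le zero_le_one] at this
  -- Since F' (1 + s k) = k, the product rule makes H constant, equal to its value 1 at s = 0.
  set H : ℝ → 𝔸 := fun s => NormedSpace.exp (-F s) * (1 + s • k) with hH
  have hexp : Continuous (NormedSpace.exp : 𝔸 → 𝔸) :=
    let _ := NormedAlgebra.restrictScalars ℚ ℂ 𝔸
    NormedSpace.exp_continuous
  have hHc : ContinuousOn H (Set.Icc 0 1) :=
    (hexp.comp_continuousOn hFc.neg).mul (by fun_prop)
  have hHd : ∀ s ∈ Set.Ico (0 : ℝ) 1, HasDerivWithinAt H 0 (Set.Ici s) s := by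
    intro s hs
    have hs' := Set.Ico_subset_Icc_self hs
    have h1 := hasDerivWithinAt_exp_of_commute (hFd s hs).neg (by
      filter_upwards [Icc_mem_nhdsGE hs.2] with t ht
      exact ((hFF s hs' t ⟨hs.1.trans ht.1, ht.2⟩).neg_left).neg_right)
    have h2 : HasDerivWithinAt (fun s : ℝ => (1 : 𝔸) + s • k) k (Set.Ici s) s := by
      simpa using! ((hasDerivAt_id s).smul_const k).const_add 1 |>.hasDerivWithinAt
    have h3 : -g s * (1 + s • k) = -k := by
      simp only [hg]; rw [neg_mul, mul_assoc, hinv s hs', mul_one]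
    refine (h1.mul h2).congr_deriv ?_
    simp only [Pi.neg_apply]
    rw [mul_assoc, h3, mul_neg, neg_add_cancel]
  have h1 := constant_of_has_deriv_right_zero hHc hHd 1 (by simp)
  simp only [hH, hF, intervalIntegral.integral_same, neg_zero, NormedSpace.exp_zero, one_smul,
    zero_smul, add_zero, mul_one] at h1
  have h2 := exp_neg_mul_exp (-∫ u in (0 : ℝ)..1, g u)
  rw [neg_neg] at h2
  calc _ = NormedSpace.exp (∫ s in (0 : ℝ)..1, g s) *
        (NormedSpace.exp (-∫ u in (0 : ℝ)..1, g u) * (1 + k)) := by rw [h1, mul_one]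
    _ = 1 + k := by rw [← mul_assoc, h2, one_mul]

end BanachAlgebra

/-! ### Existence, uniqueness and integral formula of the principal matrix logarithm. -/

section MatrixLogarithm

open scoped Matrix.Norms.Operator

variable {n : ℕ}

/-- The kernel of A is nonzero and B-invariant, so B has an eigenvector in it. This replaces
spectral mapping theorems below: the eigenvalues of commuting matrices are compared on a shared
eigenvector. -/
theorem exists_common_eigenvector {A B : Matrix (Fin n) (Fin n) ℂ} (h : Commute A B)
    (hA : ¬ IsUnit A) : ∃ v : Fin n → ℂ, v ≠ 0 ∧ A.mulVec v = 0 ∧ ∃ z : ℂ, B.mulVec v = z • v := by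
  have hdet : A.det = 0 := by
    by_contra hd
    exact hA ((Matrix.isUnit_iff_isUnit_det A).mpr (isUnit_iff_ne_zero.mpr hd))
  obtain ⟨w, hw, hAw⟩ := Matrix.exists_mulVec_eq_zero_iff.mpr hdet
  set p := LinearMap.ker A.mulVecLin with hp
  have hBp : ∀ x ∈ p, B.mulVecLin x ∈ p := by
    intro x hx
    simp only [hp, LinearMap.mem_ker, Matrix.mulVecLin_apply] at hx ⊢
    rw [Matrix.mulVec_mulVec, h.eq, ← Matrix.mulVec_mulVec, hx, Matrix.mulVec_zero]
  have hwp : w ∈ p := by simpa [hp] using hAw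
  have : Nontrivial p := ⟨⟨⟨w, hwp⟩, 0, fun h0 => hw (congrArg Subtype.val h0)⟩⟩
  obtain ⟨z, hz⟩ := Module.End.exists_eigenvalue (B.mulVecLin.restrict hBp)
  obtain ⟨v, hv⟩ := hz.exists_hasEigenvector
  refine ⟨v, fun h0 => hv.2 (Subtype.ext h0), LinearMap.mem_ker.mp v.2, z, ?_⟩
  simpa using congrArg Subtype.val hv.apply_eq_smul

theorem exists_eigenvector_of_mem_spectrum {A B : Matrix (Fin n) (Fin n) ℂ} (h : Commute A B)
    {z : ℂ} (hz : z ∈ spectrum ℂ A) :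
    ∃ v : Fin n → ℂ, v ≠ 0 ∧ A.mulVec v = z • v ∧ ∃ w : ℂ, B.mulVec v = w • v := by
  have hc : Commute (algebraMap ℂ _ z - A) B := (Algebra.commute_algebraMap_left z B).sub_left h
  obtain ⟨v, hv, h0, hw⟩ := exists_common_eigenvector hc hz
  refine ⟨v, hv, ?_, hw⟩
  rw [Matrix.sub_mulVec, sub_eq_zero, Algebra.algebraMap_eq_smul_one, Matrix.smul_mulVec,
    Matrix.one_mulVec] at h0
  exact h0.symm

theorem mem_spectrum_of_mulVec_eq {A : Matrix (Fin n) (Fin n) ℂ} {v : Fin n → ℂ} (hv : v ≠ 0)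
    {z : ℂ} (h : A.mulVec v = z • v) : z ∈ spectrum ℂ A := by
  intro hu
  obtain ⟨B, hB⟩ := hu.exists_left_inv
  apply hv
  have h0 : (algebraMap ℂ (Matrix (Fin n) (Fin n) ℂ) z - A).mulVec v = 0 := by
    rw [Matrix.sub_mulVec, Algebra.algebraMap_eq_smul_one, Matrix.smul_mulVec,
      Matrix.one_mulVec, h, sub_self]
  rw [← Matrix.one_mulVec v, ← hB, ← Matrix.mulVec_mulVec, h0, Matrix.mulVec_zero]

theorem pow_mulVec {A : Matrix (Fin n) (Fin n) ℂ} {v : Fin n → ℂ} {z : ℂ}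
    (h : A.mulVec v = z • v) (j : ℕ) : (A ^ j).mulVec v = z ^ j • v := by
  induction j with
  | zero => simp
  | succ j ih => rw [pow_succ, ← Matrix.mulVec_mulVec, h, Matrix.mulVec_smul, ih, smul_smul,
      ← pow_succ']

/-- Evaluation of a matrix at a vector, as a continuous linear map. -/
def mulVecAt (v : Fin n → ℂ) : Matrix (Fin n) (Fin n) ℂ →L[ℂ] (Fin n → ℂ) :=
  LinearMap.toContinuousLinearMap ((Matrix.mulVecBilin ℂ ℂ).flip v)

theorem mulVecAt_apply (v : Fin n → ℂ) (A : Matrix (Fin n) (Fin n) ℂ) :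
    mulVecAt v A = A.mulVec v := rfl

theorem mulVec_eq_of_hasSum {A S : Matrix (Fin n) (Fin n) ℂ} {v : Fin n → ℂ} {z s : ℂ}
    {c : ℕ → ℂ} (h : A.mulVec v = z • v) (hS : HasSum (fun j => c j • A ^ j) S)
    (hs : HasSum (fun j => c j • z ^ j) s) : S.mulVec v = s • v := by
  have h1 := (mulVecAt v).hasSum hS
  have h2 := hs.smul_const v
  refine h1.unique ?_
  simpa only [Function.comp_def, mulVecAt_apply, Matrix.smul_mulVec, pow_mulVec h, smul_assoc]
    using h2

theorem psi1_mulVec {A : Matrix (Fin n) (Fin n) ℂ} {v : Fin n → ℂ} {z : ℂ}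
    (h : A.mulVec v = z • v) : (psi1 A).mulVec v = psiSeries z • v :=
  mulVec_eq_of_hasSum h (psiSeries_hasSum A) (psiSeries_hasSum z)

theorem psi1_mul_self (X : Matrix (Fin n) (Fin n) ℂ) :
    psi1 X * X = NormedSpace.exp X - 1 := psiSeries_mul_self X

theorem commute_psi1 {X Y : Matrix (Fin n) (Fin n) ℂ} (h : Commute Y X) : Commute Y (psi1 X) :=
  commute_psiSeries h

theorem continuous_psi1 : Continuous (psi1 : Matrix (Fin n) (Fin n) ℂ → _) :=
  continuous_psiSeries

theorem continuous_matrix_exp :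
    Continuous (NormedSpace.exp : Matrix (Fin n) (Fin n) ℂ → Matrix (Fin n) (Fin n) ℂ) :=
  NormedSpace.exp_continuous

theorem matrix_exp_add {X Y : Matrix (Fin n) (Fin n) ℂ} (h : Commute X Y) :
    NormedSpace.exp (X + Y) = NormedSpace.exp X * NormedSpace.exp Y :=
  exp_add_of_commute' h

theorem matrix_exp_smul_one (c : ℂ) :
    NormedSpace.exp (c • (1 : Matrix (Fin n) (Fin n) ℂ)) = Complex.exp c • 1 := by
  rw [Complex.exp_eq_exp_ℂ, ← Algebra.algebraMap_eq_smul_one, ← Algebra.algebraMap_eq_smul_one]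
  exact (NormedSpace.algebraMap_exp_comm c).symm

/-- A zero satisfies e^z = 1, so it is an integer multiple of 2πi. The strip leaves only z = 0,
where the series is 1. -/
theorem psiSeries_ne_zero {z : ℂ} (h1 : -(2 * Real.pi) < z.im) (h2 : z.im < 2 * Real.pi) :
    psiSeries z ≠ 0 := by
  intro h0
  have h3 := psiSeries_mul_self z
  rw [h0, zero_mul, eq_comm, sub_eq_zero, ← Complex.exp_eq_exp_ℂ, Complex.exp_eq_one_iff] at h3
  obtain ⟨k, rfl⟩ := h3
  have him : ((k : ℂ) * (2 * Real.pi * Complex.I)).im = k * (2 * Real.pi) := by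
    simp
  rw [him] at h1 h2
  have hpi := Real.pi_pos
  have hk1 : (-1 : ℝ) < k := by nlinarith
  have hk2 : (k : ℝ) < 1 := by nlinarith
  have hk : k = 0 := by
    have : (-1 : ℤ) < k := by exact_mod_cast hk1
    have : k < (1 : ℤ) := by exact_mod_cast hk2
    omega
  subst hk
  have h4 := psiSeries_hasSum (0 : ℂ)
  have h5 := hasSum_single (f := fun j : ℕ => (((j + 1).factorial : ℂ)⁻¹) • (0 : ℂ) ^ j) 0
    (fun j hj => by simp [hj])
  simp only [Int.cast_zero, zero_mul] at h0
  have := h4.unique h5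
  simp [h0] at this

theorem isUnit_psi1 {X : Matrix (Fin n) (Fin n) ℂ}
    (h : ∀ z ∈ spectrum ℂ X, -(2 * Real.pi) < z.im ∧ z.im < 2 * Real.pi) : IsUnit (psi1 X) := by
  by_contra hu
  obtain ⟨v, hv, h0, z, hz⟩ := exists_common_eigenvector (commute_psi1 (Commute.refl X)).symm hu
  rw [psi1_mulVec hz] at h0
  obtain ⟨h1, h2⟩ := h z (mem_spectrum_of_mulVec_eq hv hz)
  exact (smul_ne_zero (psiSeries_ne_zero h1 h2) hv) h0

theorem continuousOn_matrix_inv {T : Type*} [TopologicalSpace T]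
    {f : T → Matrix (Fin n) (Fin n) ℂ} {S : Set T} (hf : ContinuousOn f S)
    (hu : ∀ x ∈ S, IsUnit (f x)) : ContinuousOn (fun x => (f x)⁻¹) S := by
  intro x hx
  obtain ⟨u, hfu⟩ := hu x hx
  have h := NormedRing.inverse_continuousAt u
  simp only [Matrix.nonsing_inv_eq_ringInverse]
  rw [hfu] at h
  exact ContinuousAt.comp_continuousWithinAt (g := Ring.inverse) h (hf x hx)

theorem inv_mulVec {A : Matrix (Fin n) (Fin n) ℂ} (hA : IsUnit A) {v : Fin n → ℂ} {z : ℂ}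
    (h : A.mulVec v = z • v) : A⁻¹.mulVec v = z⁻¹ • v := by
  have hd := (Matrix.isUnit_iff_isUnit_det A).mp hA
  have h1 : v = z • A⁻¹.mulVec v := by
    rw [← Matrix.mulVec_smul, ← h, Matrix.mulVec_mulVec, Matrix.nonsing_inv_mul A hd,
      Matrix.one_mulVec]
  rcases eq_or_ne z 0 with rfl | hz
  · rw [zero_smul] at h1; simp [h1]
  · nth_rewrite 2 [h1]; rw [smul_smul, inv_mul_cancel₀ hz, one_smul]

/-- No invertibility is required: the inverse of a singular matrix is 0 by convention. -/
theorem commute_inv {A B : Matrix (Fin n) (Fin n) ℂ} (h : Commute A B) : Commute A B⁻¹ := by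
  rw [Matrix.nonsing_inv_eq_ringInverse]
  by_cases hB : IsUnit B
  · obtain ⟨u, rfl⟩ := hB
    rw [Ring.inverse_unit]
    exact h.units_inv_right
  · rw [Ring.inverse_non_unit _ hB]
    exact Commute.zero_right A

/-- The integral formula for the principal logarithm. -/
def logIntegral (M : Matrix (Fin n) (Fin n) ℂ) : Matrix (Fin n) (Fin n) ℂ :=
  ∫ s in (0 : ℝ)..1, (M - 1) * (1 + (s : ℂ) • (M - 1))⁻¹

variable {M : Matrix (Fin n) (Fin n) ℂ}

theorem isUnit_one_add_smul (hM : ∀ z ∈ spectrum ℂ M, z ∈ Complex.slitPlane) {s : ℝ}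
    (hs : s ∈ Set.Icc (0 : ℝ) 1) : IsUnit (1 + (s : ℂ) • (M - 1)) := by
  rcases eq_or_lt_of_le hs.1 with h0 | h0
  · simp [← h0]
  have hs0 : (s : ℂ) ≠ 0 := by exact_mod_cast h0.ne'
  -- For s > 0 the matrix is -s((s - 1)/s - M), and (s - 1)/s is a nonpositive real.
  have h1 : (((s - 1) / s : ℝ) : ℂ) ∉ spectrum ℂ M := fun h => by
    have := Complex.ofReal_mem_slitPlane.mp (hM _ h)
    exact absurd this (not_lt.mpr (div_nonpos_of_nonpos_of_nonneg (by linarith [hs.2]) h0.le))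
  rw [spectrum.notMem_iff] at h1
  have h2 : (1 : Matrix (Fin n) (Fin n) ℂ) + (s : ℂ) • (M - 1) =
      (Units.mk0 (-(s : ℂ)) (neg_ne_zero.mpr hs0)) •
        (algebraMap ℂ _ ((((s - 1) / s : ℝ)) : ℂ) - M) := by
    rw [Units.smul_mk0, Algebra.algebraMap_eq_smul_one, smul_sub (-(s : ℂ)), smul_smul]
    have : -(s : ℂ) * (((s - 1) / s : ℝ) : ℂ) = 1 - s := by
      push_cast; field_simp; ring
    rw [this]
    module
  rw [h2]
  exact (isUnit_smul_iff _ _).mpr h1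

theorem continuousOn_logIntegrand (hM : ∀ z ∈ spectrum ℂ M, z ∈ Complex.slitPlane) :
    ContinuousOn (fun s : ℝ => (1 + (s : ℂ) • (M - 1))⁻¹) (Set.Icc 0 1) :=
  continuousOn_matrix_inv (by fun_prop) fun _ hs => isUnit_one_add_smul hM hs

theorem exp_logIntegral (hM : ∀ z ∈ spectrum ℂ M, z ∈ Complex.slitPlane) :
    NormedSpace.exp (logIntegral M) = M := by
  have hc : ∀ s t : ℝ, Commute (1 + (s : ℂ) • (M - 1)) (1 + (t : ℂ) • (M - 1)) := fun s t =>
    (Commute.one_right _).add_right ((((Commute.one_left _).add_left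
      ((Commute.refl _).smul_left _))).smul_right _)
  have hk : ∀ s : ℝ, Commute (M - 1) (1 + (s : ℂ) • (M - 1)) := fun s =>
    (Commute.one_right _).add_right ((Commute.refl _).smul_right _)
  have h := exp_integral_eq_one_add (k := M - 1) (continuousOn_logIntegrand hM)
    (fun s hs => Matrix.nonsing_inv_mul _
      ((Matrix.isUnit_iff_isUnit_det _).mp (isUnit_one_add_smul hM hs)))
    (fun s _ => commute_inv (hk s))
    (fun s _ t _ => commute_inv (commute_inv (hc t s)).symm)
  rw [add_sub_cancel] at h
  exact h

theorem continuousOn_logIntegrand_mul (hM : ∀ z ∈ spectrum ℂ M, z ∈ Complex.slitPlane) :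
    ContinuousOn (fun s : ℝ => (M - 1) * (1 + (s : ℂ) • (M - 1))⁻¹) (Set.uIcc 0 1) := by
  rw [Set.uIcc_of_le zero_le_one]
  exact continuousOn_const.mul (continuousOn_logIntegrand hM)

theorem commute_logIntegral (hM : ∀ z ∈ spectrum ℂ M, z ∈ Complex.slitPlane)
    {B : Matrix (Fin n) (Fin n) ℂ} (hB : Commute B M) : Commute B (logIntegral M) := by
  have h1 : Commute B (M - 1) := hB.sub_right (Commute.one_right B)
  exact commute_intervalIntegral (continuousOn_logIntegrand_mul hM) fun s _ =>
    h1.mul_right (commute_inv ((Commute.one_right B).add_right (h1.smul_right _)))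

/-- On an eigenvector the matrix integral reduces to log z = ∫₀¹ (z - 1)/(1 + s(z - 1)) ds. -/
theorem logIntegral_mulVec (hM : ∀ z ∈ spectrum ℂ M, z ∈ Complex.slitPlane)
    {v : Fin n → ℂ} (hv : v ≠ 0) {z : ℂ} (h : M.mulVec v = z • v) :
    (logIntegral M).mulVec v = Complex.log z • v := by
  have hz := hM z (mem_spectrum_of_mulVec_eq hv h)
  have h1 : ∫ s in (0 : ℝ)..1, ((M - 1) * (1 + (s : ℂ) • (M - 1))⁻¹).mulVec v =
      (logIntegral M).mulVec v :=
    map_intervalIntegral (mulVecAt v) (continuousOn_logIntegrand_mul hM)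
  have h2 := Complex.log_eq_integral (z := z - 1) (by rwa [add_sub_cancel])
  rw [add_sub_cancel] at h2
  rw [← h1, h2, ← intervalIntegral.integral_const_mul,
    ← intervalIntegral.integral_smul_const]
  refine intervalIntegral.integral_congr fun s hs => ?_
  rw [Set.uIcc_of_le zero_le_one] at hs
  have h3 : (M - 1).mulVec v = (z - 1) • v := by
    rw [Matrix.sub_mulVec, h, Matrix.one_mulVec, sub_smul, one_smul]
  have h4 : (1 + (s : ℂ) • (M - 1)).mulVec v = (1 + s * (z - 1)) • v := by
    rw [Matrix.add_mulVec, Matrix.one_mulVec, Matrix.smul_mulVec, h3, smul_smul, add_smul,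
      one_smul]
  rw [← Matrix.mulVec_mulVec, inv_mulVec (isUnit_one_add_smul hM hs) h4, Matrix.mulVec_smul, h3,
    smul_smul, mul_comm]
  simp

theorem isPrincipalLog_logIntegral (hM : ∀ z ∈ spectrum ℂ M, z ∈ Complex.slitPlane) :
    IsPrincipalLog M (logIntegral M) := by
  refine ⟨exp_logIntegral hM, fun z hz => ?_⟩
  obtain ⟨v, hv, h1, w, h2⟩ := exists_eigenvector_of_mem_spectrum
    (commute_logIntegral hM (Commute.refl M)).symm hz
  have h3 := logIntegral_mulVec hM hv h2
  have h4 : z = Complex.log w := smul_left_injective ℂ hv (h1.symm.trans h3)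
  have hw := hM w (mem_spectrum_of_mulVec_eq hv h2)
  rw [h4, Complex.log_im]
  exact ⟨Complex.neg_pi_lt_arg w,
    lt_of_le_of_ne (Complex.arg_le_pi w) (Complex.mem_slitPlane_iff_arg.mp hw).1⟩

/-- Two principal logarithms commute, so their difference D has e^D = I and eigenvalues with |Im| <
2π. Thus ψ₁(D) is invertible while ψ₁(D)D = 0. -/
theorem isPrincipalLog_unique (hM : ∀ z ∈ spectrum ℂ M, z ∈ Complex.slitPlane)
    {Q : Matrix (Fin n) (Fin n) ℂ} (hQ : IsPrincipalLog M Q) : Q = logIntegral M := by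
  have hP := isPrincipalLog_logIntegral hM
  have hQM : Commute Q M := by
    rw [← hQ.1]
    exact (Commute.refl Q).exp_right
  have hQL : Commute Q (logIntegral M) := commute_logIntegral hM hQM
  set D := Q - logIntegral M with hD
  have hDQ : Commute D Q := (Commute.refl Q).sub_left hQL.symm
  have hexp : NormedSpace.exp D = 1 := by
    have h1 : NormedSpace.exp (D + logIntegral M) =
        NormedSpace.exp D * NormedSpace.exp (logIntegral M) :=
      matrix_exp_add (hQL.sub_left (Commute.refl _))
    rw [hD, sub_add_cancel, hQ.1, hP.1, ← hD] at h1
    have hu : IsUnit M := hQ.1 ▸ Matrix.isUnit_exp Q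
    exact (hu.mul_eq_right.mp h1.symm)
  have hu : IsUnit (psi1 D) := isUnit_psi1 fun z hz => by
    obtain ⟨v, hv, h1, w, h2⟩ := exists_eigenvector_of_mem_spectrum hDQ hz
    have h3 : (logIntegral M).mulVec v = (w - z) • v := by
      have : logIntegral M = Q - D := by rw [hD, sub_sub_cancel]
      rw [this, Matrix.sub_mulVec, h1, h2, sub_smul]
    have h4 := hQ.2 w (mem_spectrum_of_mulVec_eq hv h2)
    have h5 := hP.2 (w - z) (mem_spectrum_of_mulVec_eq hv h3)
    rw [Complex.sub_im] at h5
    constructor <;> linarith [h4.1, h4.2, h5.1, h5.2]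
  have h0 : psi1 D * D = 0 := by rw [psi1_mul_self, hexp, sub_self]
  exact sub_eq_zero.mp ((hu.mul_right_eq_zero).mp h0)

theorem hasPrincipalLog_of_spectrum (hM : ∀ z ∈ spectrum ℂ M, z ∈ Complex.slitPlane) :
    HasPrincipalLog M :=
  ⟨hM, logIntegral M, isPrincipalLog_logIntegral hM, fun _ hQ => isPrincipalLog_unique hM hQ⟩

theorem matrixLog_eq_logIntegral (hM : ∀ z ∈ spectrum ℂ M, z ∈ Complex.slitPlane) :
    matrixLog M = logIntegral M := by
  have h : ∃ Q, IsPrincipalLog M Q := ⟨_, isPrincipalLog_logIntegral hM⟩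
  rw [matrixLog, dif_pos h]
  exact isPrincipalLog_unique hM h.choose_spec

end MatrixLogarithm

/-! ### The half-angle substitution for matrix pencils. -/

section Pencil

open scoped Matrix.Norms.Operator

theorem continuousAt_intervalIntegral {X F : Type*} [TopologicalSpace X]
    [FirstCountableTopology X] [NormedAddCommGroup F] [NormedSpace ℝ F] {f : X → ℝ → F}
    {S : Set X} {x₀ : X} {a b : ℝ} (hS : S ∈ 𝓝 x₀)
    (hf : ContinuousOn (Function.uncurry f) (S ×ˢ Set.uIcc a b)) :
    ContinuousAt (fun x => ∫ t in a..b, f x t) x₀ := by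
  have hab : min a b ≤ max a b := min_le_max
  -- Clamping t to the interval makes the integrand continuous for every real t without changing the
  -- integral.
  set g : S → ℝ → F := fun x t => f x (Set.projIcc _ _ hab t) with hg
  have hgc : Continuous (Function.uncurry g) :=
    hf.comp_continuous (f := fun p : S × ℝ => ((p.1 : X), (Set.projIcc _ _ hab p.2 : ℝ)))
      (by fun_prop) fun p => ⟨p.1.2, (Set.projIcc _ _ hab p.2).2⟩
  have h1 : Continuous fun x : S => ∫ t in a..b, g x t :=
    intervalIntegral.continuous_parametric_intervalIntegral_of_continuous' hgc a b
  have h2 : ContinuousOn (fun x => ∫ t in a..b, f x t) S := by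
    rw [continuousOn_iff_continuous_domRestrict]
    convert h1 using 2 with x
    refine intervalIntegral.integral_congr fun t ht => ?_
    simp only [hg]
    rw [Set.projIcc_of_mem hab ht]
  exact h2.continuousAt hS

variable {n : ℕ}

/-- The matrix `e^{jθ} E - A` of a complex pencil. -/
def pencilC (A E : Matrix (Fin n) (Fin n) ℂ) (θ : ℝ) : Matrix (Fin n) (Fin n) ℂ :=
  Complex.exp (Complex.I * θ) • E - A

/-- The matrix `(E + A) t - j (E - A)` of a complex pencil. -/
def gammaC (A E : Matrix (Fin n) (Fin n) ℂ) (t : ℝ) : Matrix (Fin n) (Fin n) ℂ :=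
  (t : ℂ) • (E + A) - Complex.I • (E - A)

theorem cos_half_pos {θ : ℝ} (hθ : θ ∈ Set.Ioo (-Real.pi) Real.pi) : 0 < Real.cos (θ / 2) :=
  Real.cos_pos_of_mem_Ioo ⟨by linarith [hθ.1], by linarith [hθ.2]⟩

/-- The factor relating `gammaC` to `pencilC`. -/
def gammaFactor (θ : ℝ) : ℂ :=
  -(Complex.I * Complex.exp (-(Complex.I * (θ / 2)))) / Real.cos (θ / 2)

theorem gammaFactor_ne_zero {θ : ℝ} (hθ : θ ∈ Set.Ioo (-Real.pi) Real.pi) : gammaFactor θ ≠ 0 := by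
  have h : (Real.cos (θ / 2) : ℂ) ≠ 0 := by exact_mod_cast (cos_half_pos hθ).ne'
  exact div_ne_zero (neg_ne_zero.mpr (mul_ne_zero Complex.I_ne_zero (Complex.exp_ne_zero _))) h

theorem two_mul_cos_half (θ : ℝ) : 2 * (Real.cos (θ / 2) : ℂ) =
    Complex.exp (Complex.I * (θ / 2)) + Complex.exp (-(Complex.I * (θ / 2))) := by
  push_cast
  rw [Complex.two_cos]
  ring_nf

theorem exp_I_mul_eq_sq (θ : ℝ) :
    Complex.exp (Complex.I * θ) = Complex.exp (Complex.I * (θ / 2)) ^ 2 := by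
  rw [← Complex.exp_nat_mul]; congr 1; push_cast; ring

theorem exp_half_mul_neg (θ : ℝ) :
    Complex.exp (Complex.I * (θ / 2)) * Complex.exp (-(Complex.I * (θ / 2))) = 1 := by
  rw [← Complex.exp_add, add_neg_cancel, Complex.exp_zero]

theorem tan_half_mul_cos {θ : ℝ} (hθ : θ ∈ Set.Ioo (-Real.pi) Real.pi) :
    (Real.tan (θ / 2) : ℂ) * Real.cos (θ / 2) = Real.sin (θ / 2) := by
  exact_mod_cast Real.tan_mul_cos (cos_half_pos hθ).ne'

theorem cos_add_I_sin_half (θ : ℝ) : Complex.exp (Complex.I * (θ / 2)) =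
    Real.cos (θ / 2) + Complex.I * Real.sin (θ / 2) := by
  rw [mul_comm, Complex.exp_mul_I]; push_cast; ring

theorem cos_sub_I_sin_half (θ : ℝ) : Complex.exp (-(Complex.I * (θ / 2))) =
    Real.cos (θ / 2) - Complex.I * Real.sin (θ / 2) := by
  rw [← mul_neg, mul_comm, Complex.exp_mul_I, Complex.cos_neg, Complex.sin_neg]; push_cast; ring

theorem tan_half_sub_I {θ : ℝ} (hθ : θ ∈ Set.Ioo (-Real.pi) Real.pi) :
    (Real.tan (θ / 2) : ℂ) - Complex.I = gammaFactor θ * Complex.exp (Complex.I * θ) := by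
  have h : (Real.cos (θ / 2) : ℂ) ≠ 0 := by exact_mod_cast (cos_half_pos hθ).ne'
  have h1 : gammaFactor θ * Complex.exp (Complex.I * θ) =
      -(Complex.I * Complex.exp (Complex.I * (θ / 2))) / Real.cos (θ / 2) := by
    rw [gammaFactor, exp_I_mul_eq_sq]
    linear_combination -(Complex.I * Complex.exp (Complex.I * (θ / 2)) / Real.cos (θ / 2)) *
      exp_half_mul_neg θ
  rw [h1, eq_div_iff h, cos_add_I_sin_half]
  linear_combination tan_half_mul_cos hθ + Real.sin (θ / 2) * Complex.I_sq

theorem tan_half_add_I {θ : ℝ} (hθ : θ ∈ Set.Ioo (-Real.pi) Real.pi) :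
    (Real.tan (θ / 2) : ℂ) + Complex.I = -gammaFactor θ := by
  have h : (Real.cos (θ / 2) : ℂ) ≠ 0 := by exact_mod_cast (cos_half_pos hθ).ne'
  rw [gammaFactor, neg_div, neg_neg, eq_div_iff h, cos_sub_I_sin_half]
  linear_combination tan_half_mul_cos hθ + Real.sin (θ / 2) * Complex.I_sq

theorem gammaC_tan_half (A E : Matrix (Fin n) (Fin n) ℂ) {θ : ℝ}
    (hθ : θ ∈ Set.Ioo (-Real.pi) Real.pi) :
    gammaC A E (Real.tan (θ / 2)) = gammaFactor θ • pencilC A E θ := by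
  have h : gammaC A E (Real.tan (θ / 2)) = ((Real.tan (θ / 2) : ℂ) - Complex.I) • E +
      ((Real.tan (θ / 2) : ℂ) + Complex.I) • A := by
    rw [gammaC]; module
  rw [h, tan_half_sub_I hθ, tan_half_add_I hθ, pencilC]
  module

theorem isUnit_smul_matrix {c : ℂ} (hc : c ≠ 0) {X : Matrix (Fin n) (Fin n) ℂ} (hX : IsUnit X) :
    IsUnit (c • X) :=
  (isUnit_smul_iff (Units.mk0 c hc) X).mpr hX

theorem smul_matrix_inv {c : ℂ} (hc : c ≠ 0) {X : Matrix (Fin n) (Fin n) ℂ} (hX : IsUnit X) :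
    (c • X)⁻¹ = c⁻¹ • X⁻¹ := by
  refine Matrix.inv_eq_left_inv ?_
  rw [smul_mul_smul_comm, inv_mul_cancel₀ hc, one_smul,
    Matrix.nonsing_inv_mul _ ((Matrix.isUnit_iff_isUnit_det X).mp hX)]

theorem matrix_mul_inv {X : Matrix (Fin n) (Fin n) ℂ} (hX : IsUnit X) : X * X⁻¹ = 1 :=
  Matrix.mul_nonsing_inv X ((Matrix.isUnit_iff_isUnit_det X).mp hX)

theorem matrix_inv_mul {X : Matrix (Fin n) (Fin n) ℂ} (hX : IsUnit X) : X⁻¹ * X = 1 :=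
  Matrix.nonsing_inv_mul X ((Matrix.isUnit_iff_isUnit_det X).mp hX)

theorem mem_Ioo_of_mem_uIcc {θ₁ θ₂ θ : ℝ} (hθ₁ : θ₁ ∈ Set.Ioo (-Real.pi) Real.pi)
    (hθ₂ : θ₂ ∈ Set.Ioo (-Real.pi) Real.pi) (hθ : θ ∈ Set.uIcc θ₁ θ₂) :
    θ ∈ Set.Ioo (-Real.pi) Real.pi :=
  Set.OrdConnected.uIcc_subset inferInstance hθ₁ hθ₂ hθ

theorem two_mul_arctan_tan_half {θ : ℝ} (hθ : θ ∈ Set.Ioo (-Real.pi) Real.pi) :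
    2 * Real.arctan (Real.tan (θ / 2)) = θ := by
  rw [Real.arctan_tan (by linarith [hθ.1]) (by linarith [hθ.2])]; ring

end Pencil

/-! ### The logarithm as an integral over θ, and the identities for `pencilY`. -/

section PencilIntegral

open scoped Matrix.Norms.Operator

variable {n : ℕ} {A E : Matrix (Fin n) (Fin n) ℂ} {θ₁ θ₂ : ℝ}

theorem isUnit_gammaC_tan_half {θ : ℝ} (hθ : θ ∈ Set.Ioo (-Real.pi) Real.pi)
    (hR : IsUnit (pencilC A E θ)) : IsUnit (gammaC A E (Real.tan (θ / 2))) := by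
  rw [gammaC_tan_half A E hθ]
  exact isUnit_smul_matrix (gammaFactor_ne_zero hθ) hR

/-- The monotone map t ↦ 2 arctan t carries the t-interval into the θ-interval, where the pencil is
invertible. -/
theorem isUnit_gammaC (hθ₁ : θ₁ ∈ Set.Ioo (-Real.pi) Real.pi)
    (hθ₂ : θ₂ ∈ Set.Ioo (-Real.pi) Real.pi)
    (hR : ∀ θ ∈ Set.uIcc θ₁ θ₂, IsUnit (pencilC A E θ)) {t : ℝ}
    (ht : t ∈ Set.uIcc (Real.tan (θ₁ / 2)) (Real.tan (θ₂ / 2))) : IsUnit (gammaC A E t) := by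
  have hm : Monotone fun t : ℝ => 2 * Real.arctan t := fun x y hxy =>
    mul_le_mul_of_nonneg_left (Real.arctan_strictMono.monotone hxy) zero_le_two
  have h := hm.mapsTo_uIcc ht
  simp only [two_mul_arctan_tan_half hθ₁, two_mul_arctan_tan_half hθ₂] at h
  have h1 := isUnit_gammaC_tan_half (mem_Ioo_of_mem_uIcc hθ₁ hθ₂ h) (hR _ h)
  rwa [mul_div_cancel_left₀ _ (two_ne_zero' ℝ), Real.tan_arctan] at h1

theorem gammaC_combination (A E : Matrix (Fin n) (Fin n) ℂ) (t₁ t₂ s : ℝ) :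
    gammaC A E (t₁ + (t₂ - t₁) * s) =
      gammaC A E t₁ + (s : ℂ) • (gammaC A E t₂ - gammaC A E t₁) := by
  simp only [gammaC]
  push_cast
  module

/-- For r ≥ 0, -r - M is -(1 + r) times Γ(t)Γ(t₁)⁻¹, where t is the point of the segment with
parameter 1/(1 + r); hence it is invertible. -/
theorem spectrum_gammaC_quot {t₁ t₂ : ℝ}
    (hG : ∀ t ∈ Set.uIcc t₁ t₂, IsUnit (gammaC A E t)) :
    ∀ z ∈ spectrum ℂ (gammaC A E t₂ * (gammaC A E t₁)⁻¹), z ∈ Complex.slitPlane := by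
  intro z hz
  by_contra hz'
  have h0 : z.re ≤ 0 ∧ z.im = 0 := by
    rw [Complex.mem_slitPlane_iff] at hz'
    push Not at hz'
    exact hz'
  obtain ⟨r, hr, rfl⟩ : ∃ r : ℝ, 0 ≤ r ∧ z = ((-r : ℝ) : ℂ) :=
    ⟨-z.re, by linarith [h0.1], Complex.ext (by simp) (by simp [h0.2])⟩
  have h1 : (1 + r) ≠ 0 := by positivity
  have h1c : (1 + (r : ℂ)) ≠ 0 := by exact_mod_cast h1
  have hs : (1 / (1 + r)) ∈ Set.Icc (0 : ℝ) 1 :=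
    ⟨by positivity, by rw [div_le_one (by positivity)]; linarith⟩
  have ht : t₁ + (t₂ - t₁) * (1 / (1 + r)) ∈ Set.uIcc t₁ t₂ := by
    rw [← segment_eq_uIcc, segment_eq_image']
    exact ⟨_, hs, by simp [mul_comm]⟩
  have hu := isUnit_smul_matrix (neg_ne_zero.mpr h1c) ((hG _ ht).mul
    (Matrix.isUnit_nonsing_inv_iff.mpr (hG t₁ Set.left_mem_uIcc)))
  apply hz
  suffices h3 : algebraMap ℂ _ ((-r : ℝ) : ℂ) - gammaC A E t₂ * (gammaC A E t₁)⁻¹ =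
      -(1 + (r : ℂ)) • (gammaC A E (t₁ + (t₂ - t₁) * (1 / (1 + r))) * (gammaC A E t₁)⁻¹) by
    rw [← h3] at hu
    exact hu
  have h2 : (1 + (r : ℂ)) • gammaC A E (t₁ + (t₂ - t₁) * (1 / (1 + r))) =
      gammaC A E t₂ + (r : ℂ) • gammaC A E t₁ := by
    rw [gammaC_combination, smul_add, smul_smul]
    have : (1 + (r : ℂ)) * ((1 / (1 + r) : ℝ) : ℂ) = 1 := by push_cast; field_simp
    rw [this]
    module
  rw [neg_smul, ← smul_mul_assoc, h2, add_mul, smul_mul_assoc,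
    matrix_mul_inv (hG t₁ Set.left_mem_uIcc), Algebra.algebraMap_eq_smul_one]
  push_cast
  module

theorem continuous_gammaC (A E : Matrix (Fin n) (Fin n) ℂ) : Continuous (gammaC A E) := by
  unfold gammaC
  fun_prop

theorem continuous_pencilC (A E : Matrix (Fin n) (Fin n) ℂ) : Continuous (pencilC A E) := by
  unfold pencilC
  fun_prop

/-- Substitute t = t₁ + (t₂ - t₁)s; the factors Γ(t₁)⁻¹ cancel. -/
theorem logIntegral_gammaC_quot {t₁ t₂ : ℝ}
    (hG : ∀ t ∈ Set.uIcc t₁ t₂, IsUnit (gammaC A E t)) :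
    logIntegral (gammaC A E t₂ * (gammaC A E t₁)⁻¹) =
      ∫ t in t₁..t₂, (E + A) * (gammaC A E t)⁻¹ := by
  have hG₁ := hG t₁ Set.left_mem_uIcc
  have hd : gammaC A E t₂ * (gammaC A E t₁)⁻¹ - 1 =
      (gammaC A E t₂ - gammaC A E t₁) * (gammaC A E t₁)⁻¹ := by
    rw [sub_mul, matrix_mul_inv hG₁]
  have hsub : gammaC A E t₂ - gammaC A E t₁ = (t₂ - t₁) • (E + A) := by
    rw [← Complex.coe_smul]
    simp only [gammaC]
    push_cast
    module
  have h := intervalIntegral.smul_integral_comp_add_mul (a := 0) (b := 1)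
    (fun t => (E + A) * (gammaC A E t)⁻¹) (t₂ - t₁) t₁
  rw [mul_zero, add_zero, mul_one, add_sub_cancel] at h
  rw [← h, ← intervalIntegral.integral_smul, logIntegral]
  refine intervalIntegral.integral_congr fun s hs => ?_
  rw [Set.uIcc_of_le zero_le_one] at hs
  have ht : t₁ + (t₂ - t₁) * s ∈ Set.uIcc t₁ t₂ := by
    rw [← segment_eq_uIcc, segment_eq_image']
    exact ⟨_, hs, by simp [mul_comm]⟩
  have h1 : 1 + (s : ℂ) • (gammaC A E t₂ * (gammaC A E t₁)⁻¹ - 1) =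
      gammaC A E (t₁ + (t₂ - t₁) * s) * (gammaC A E t₁)⁻¹ := by
    rw [hd, gammaC_combination, add_mul, matrix_mul_inv hG₁, smul_mul_assoc]
  rw [h1, hd, Matrix.mul_inv_rev,
    Matrix.nonsing_inv_nonsing_inv _ ((Matrix.isUnit_iff_isUnit_det _).mp hG₁), mul_assoc,
    ← mul_assoc (gammaC A E t₁)⁻¹, matrix_inv_mul hG₁, one_mul, hsub, smul_mul_assoc]

theorem hasDerivAt_tan_half {θ : ℝ} (hθ : θ ∈ Set.Ioo (-Real.pi) Real.pi) :
    HasDerivAt (fun θ : ℝ => Real.tan (θ / 2)) (1 / (2 * Real.cos (θ / 2) ^ 2)) θ := by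
  have h := (Real.hasDerivAt_tan (cos_half_pos hθ).ne').comp θ ((hasDerivAt_id θ).div_const 2)
  refine h.congr_deriv ?_
  have := (cos_half_pos hθ).ne'
  field_simp

/-- The weight `j e^{jθ/2} / (2 cos (θ/2))`. -/
def halfWeight (θ : ℝ) : ℂ :=
  Complex.I * Complex.exp (Complex.I * (θ / 2)) / (2 * Real.cos (θ / 2))

theorem halfWeight_eq {θ : ℝ} (hθ : θ ∈ Set.Ioo (-Real.pi) Real.pi) :
    ((1 / (2 * Real.cos (θ / 2) ^ 2) : ℝ) : ℂ) * (gammaFactor θ)⁻¹ = halfWeight θ := by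
  have h : (Real.cos (θ / 2) : ℂ) ≠ 0 := by exact_mod_cast (cos_half_pos hθ).ne'
  rw [← div_eq_mul_inv, div_eq_iff (gammaFactor_ne_zero hθ), halfWeight, gammaFactor]
  rw [Complex.ofReal_div, Complex.ofReal_mul, Complex.ofReal_pow]
  have h2 := exp_half_mul_neg θ
  generalize Complex.exp (Complex.I * (θ / 2)) = a at *
  generalize Complex.exp (-(Complex.I * (θ / 2))) = b at *
  generalize (Real.cos (θ / 2) : ℂ) = c at *
  push_cast
  field_simp
  linear_combination Complex.I ^ 2 * h2 + Complex.I_sq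

theorem logIntegral_gammaC_quot_eq (hθ₁ : θ₁ ∈ Set.Ioo (-Real.pi) Real.pi)
    (hθ₂ : θ₂ ∈ Set.Ioo (-Real.pi) Real.pi)
    (hR : ∀ θ ∈ Set.uIcc θ₁ θ₂, IsUnit (pencilC A E θ)) :
    logIntegral (gammaC A E (Real.tan (θ₂ / 2)) * (gammaC A E (Real.tan (θ₁ / 2)))⁻¹) =
      ∫ θ in θ₁..θ₂, halfWeight θ • ((E + A) * (pencilC A E θ)⁻¹) := by
  rw [logIntegral_gammaC_quot fun t ht => isUnit_gammaC hθ₁ hθ₂ hR ht]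
  have hI : ∀ θ ∈ Set.uIcc θ₁ θ₂, θ ∈ Set.Ioo (-Real.pi) Real.pi := fun θ hθ =>
    mem_Ioo_of_mem_uIcc hθ₁ hθ₂ hθ
  have h := intervalIntegral.integral_deriv_smul_comp' (a := θ₁) (b := θ₂)
    (f := fun θ : ℝ => Real.tan (θ / 2)) (f' := fun θ : ℝ => 1 / (2 * Real.cos (θ / 2) ^ 2))
    (g := fun t => (E + A) * (gammaC A E t)⁻¹) (fun θ hθ => hasDerivAt_tan_half (hI θ hθ))
    (ContinuousOn.div (by fun_prop) (by fun_prop) fun θ hθ => by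
      have := (cos_half_pos (hI θ hθ)).ne'
      positivity)
    (continuousOn_const.mul (continuousOn_matrix_inv (continuous_gammaC A E).continuousOn (by
      rintro _ ⟨θ, hθ, rfl⟩
      exact isUnit_gammaC_tan_half (hI θ hθ) (hR θ hθ))))
  rw [← h]
  refine intervalIntegral.integral_congr fun θ hθ => ?_
  dsimp only [Function.comp]
  rw [gammaC_tan_half A E (hI θ hθ), smul_matrix_inv (gammaFactor_ne_zero (hI θ hθ)) (hR θ hθ),
    mul_smul_comm, ← Complex.coe_smul, smul_smul, halfWeight_eq (hI θ hθ)]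

theorem continuousOn_pencilC_inv (hR : ∀ θ ∈ Set.uIcc θ₁ θ₂, IsUnit (pencilC A E θ)) :
    ContinuousOn (fun θ => (pencilC A E θ)⁻¹) (Set.uIcc θ₁ θ₂) :=
  continuousOn_matrix_inv (continuous_pencilC A E).continuousOn hR

theorem continuousOn_halfWeight (hθ₁ : θ₁ ∈ Set.Ioo (-Real.pi) Real.pi)
    (hθ₂ : θ₂ ∈ Set.Ioo (-Real.pi) Real.pi) : ContinuousOn halfWeight (Set.uIcc θ₁ θ₂) := by
  refine ContinuousOn.div (by fun_prop) (by fun_prop) fun θ hθ => ?_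
  have h := (cos_half_pos (mem_Ioo_of_mem_uIcc hθ₁ hθ₂ hθ)).ne'
  exact_mod_cast mul_ne_zero two_ne_zero h

theorem isUnit_pencilC_zero_one (θ : ℝ) :
    IsUnit (pencilC (0 : Matrix (Fin n) (Fin n) ℂ) 1 θ) := by
  rw [pencilC, sub_zero]
  exact isUnit_smul_matrix (Complex.exp_ne_zero _) isUnit_one

theorem matrix_eq_smul_one_of_mulVec {X : Matrix (Fin n) (Fin n) ℂ} {c : ℂ}
    (h : ∀ v : Fin n → ℂ, v ≠ 0 → X.mulVec v = c • v) : X = c • 1 := by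
  refine Matrix.ext_of_mulVec_single fun i => ?_
  rw [h _ (by simp), Matrix.smul_mulVec, Matrix.one_mulVec]

/-- This is the log integral for the pencil A = 0, E = 1, whose Γ(θ) is the scalar tan(θ/2) - j. -/
theorem eta_smul_one (hθ₁ : θ₁ ∈ Set.Ioo (-Real.pi) Real.pi)
    (hθ₂ : θ₂ ∈ Set.Ioo (-Real.pi) Real.pi) :
    eta θ₁ θ₂ • (1 : Matrix (Fin n) (Fin n) ℂ) = ∫ θ in θ₁..θ₂,
      (halfWeight θ * Complex.exp (-(Complex.I * θ))) • (1 : Matrix (Fin n) (Fin n) ℂ) := by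
  have hR : ∀ θ ∈ Set.uIcc θ₁ θ₂, IsUnit (pencilC (0 : Matrix (Fin n) (Fin n) ℂ) 1 θ) :=
    fun θ _ => isUnit_pencilC_zero_one θ
  have h1 := logIntegral_gammaC_quot_eq hθ₁ hθ₂ hR
  have h2 := spectrum_gammaC_quot fun t ht => isUnit_gammaC hθ₁ hθ₂ hR ht
  have hg : ∀ θ : ℝ, gammaC (0 : Matrix (Fin n) (Fin n) ℂ) 1 (Real.tan (θ / 2)) =
      ((Real.tan (θ / 2) : ℂ) - Complex.I) • 1 := fun θ => by rw [gammaC]; module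
  have hne : (Real.tan (θ₁ / 2) : ℂ) - Complex.I ≠ 0 := by
    rw [tan_half_sub_I hθ₁]
    exact mul_ne_zero (gammaFactor_ne_zero hθ₁) (Complex.exp_ne_zero _)
  rw [hg, hg, smul_matrix_inv hne isUnit_one, inv_one, smul_mul_smul_comm, mul_one,
    ← div_eq_mul_inv] at h1 h2
  rw [← matrix_eq_smul_one_of_mulVec (c := eta θ₁ θ₂) fun v hv => logIntegral_mulVec h2 hv
    (by rw [Matrix.smul_mulVec, Matrix.one_mulVec]), h1]
  refine intervalIntegral.integral_congr fun θ _ => ?_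
  rw [pencilC, sub_zero, smul_matrix_inv (Complex.exp_ne_zero _) isUnit_one, inv_one, add_zero,
    one_mul, smul_smul, Complex.exp_neg]

/-- The matrix `Y` of a complex pencil. -/
def pencilY (A E : Matrix (Fin n) (Fin n) ℂ) (θ₁ θ₂ : ℝ) : Matrix (Fin n) (Fin n) ℂ :=
  -(eta θ₁ θ₂ • (1 : Matrix (Fin n) (Fin n) ℂ)) +
    matrixLog (gammaC A E (Real.tan (θ₂ / 2)) * (gammaC A E (Real.tan (θ₁ / 2)))⁻¹)

/-- The integral of `(e^{jθ} E - A)⁻¹` for a complex pencil. -/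
def pencilJ (A E : Matrix (Fin n) (Fin n) ℂ) (θ₁ θ₂ : ℝ) : Matrix (Fin n) (Fin n) ℂ :=
  ∫ θ in θ₁..θ₂, (pencilC A E θ)⁻¹

theorem integral_matrix_sub {f g : ℝ → Matrix (Fin n) (Fin n) ℂ} {a b : ℝ}
    (hf : ContinuousOn f (Set.uIcc a b)) (hg : ContinuousOn g (Set.uIcc a b)) :
    ∫ t in a..b, (f t - g t) = (∫ t in a..b, f t) - ∫ t in a..b, g t :=
  intervalIntegral.integral_sub hf.intervalIntegrable hg.intervalIntegrable

theorem integral_matrix_const_mul (C : Matrix (Fin n) (Fin n) ℂ)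
    {f : ℝ → Matrix (Fin n) (Fin n) ℂ} {a b : ℝ} (hf : ContinuousOn f (Set.uIcc a b)) :
    ∫ t in a..b, C * f t = C * ∫ t in a..b, f t :=
  map_intervalIntegral (ContinuousLinearMap.mul ℂ (Matrix (Fin n) (Fin n) ℂ) C) hf

theorem pencilY_eq (hθ₁ : θ₁ ∈ Set.Ioo (-Real.pi) Real.pi)
    (hθ₂ : θ₂ ∈ Set.Ioo (-Real.pi) Real.pi)
    (hR : ∀ θ ∈ Set.uIcc θ₁ θ₂, IsUnit (pencilC A E θ)) :
    pencilY A E θ₁ θ₂ = Complex.I • (A * pencilJ A E θ₁ θ₂) := by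
  have hsp := spectrum_gammaC_quot fun t ht => isUnit_gammaC hθ₁ hθ₂ hR ht
  have hw := continuousOn_halfWeight hθ₁ hθ₂
  have hc := continuousOn_pencilC_inv hR
  have hc1 : ContinuousOn (fun θ => halfWeight θ • ((E + A) * (pencilC A E θ)⁻¹))
      (Set.uIcc θ₁ θ₂) := hw.smul (continuousOn_const.mul hc)
  have hc2 : ContinuousOn (fun θ : ℝ => (halfWeight θ * Complex.exp (-(Complex.I * θ))) •
      (1 : Matrix (Fin n) (Fin n) ℂ)) (Set.uIcc θ₁ θ₂) :=
    (hw.mul (by fun_prop)).smul continuousOn_const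
  rw [pencilY, matrixLog_eq_logIntegral hsp, logIntegral_gammaC_quot_eq hθ₁ hθ₂ hR,
    eta_smul_one hθ₁ hθ₂, neg_add_eq_sub, ← smul_mul_assoc, pencilJ,
    ← integral_matrix_const_mul _ hc,
    ← integral_matrix_sub hc1 hc2]
  refine intervalIntegral.integral_congr fun θ hθ => ?_
  have hθI := mem_Ioo_of_mem_uIcc hθ₁ hθ₂ hθ
  have h : (Real.cos (θ / 2) : ℂ) ≠ 0 := by exact_mod_cast (cos_half_pos hθI).ne'
  have hw1 : halfWeight θ * (1 + Complex.exp (-(Complex.I * θ))) = Complex.I := by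
    have h1 : Complex.exp (-(Complex.I * θ)) = Complex.exp (-(Complex.I * (θ / 2))) ^ 2 := by
      rw [← Complex.exp_nat_mul]; congr 1; push_cast; ring
    rw [halfWeight, div_mul_eq_mul_div, div_eq_iff (mul_ne_zero two_ne_zero h),
      two_mul_cos_half, h1]
    linear_combination Complex.I * Complex.exp (-(Complex.I * (θ / 2))) * exp_half_mul_neg θ
  -- After multiplication by R(θ)⁻¹ and the weight, the first term is the integrand of η and the
  -- second is jA R(θ)⁻¹.
  have hE : E + A = Complex.exp (-(Complex.I * θ)) • pencilC A E θ +
      (1 + Complex.exp (-(Complex.I * θ))) • A := by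
    rw [pencilC, smul_sub, smul_smul, ← Complex.exp_add, neg_add_cancel, Complex.exp_zero]
    module
  rw [hE, add_mul, smul_mul_assoc, matrix_mul_inv (hR θ hθ), smul_add, smul_smul,
    add_sub_cancel_left, smul_mul_assoc, smul_smul, hw1, smul_mul_assoc]

theorem exp_pencilY_mul (hθ₁ : θ₁ ∈ Set.Ioo (-Real.pi) Real.pi)
    (hθ₂ : θ₂ ∈ Set.Ioo (-Real.pi) Real.pi)
    (hR : ∀ θ ∈ Set.uIcc θ₁ θ₂, IsUnit (pencilC A E θ)) :
    NormedSpace.exp (pencilY A E θ₁ θ₂) * pencilC A E θ₁ =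
      Complex.exp (Complex.I * θ₁ - Complex.I * θ₂) • pencilC A E θ₂ := by
  have hG : ∀ t ∈ Set.uIcc (Real.tan (θ₁ / 2)) (Real.tan (θ₂ / 2)), IsUnit (gammaC A E t) :=
    fun t ht => isUnit_gammaC hθ₁ hθ₂ hR ht
  have hsp := spectrum_gammaC_quot hG
  have hne : ∀ {θ : ℝ}, θ ∈ Set.Ioo (-Real.pi) Real.pi →
      gammaFactor θ * Complex.exp (Complex.I * θ) ≠ 0 := fun h =>
    mul_ne_zero (gammaFactor_ne_zero h) (Complex.exp_ne_zero _)
  have h1 : Complex.exp (-eta θ₁ θ₂) = gammaFactor θ₁ * Complex.exp (Complex.I * θ₁) /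
      (gammaFactor θ₂ * Complex.exp (Complex.I * θ₂)) := by
    rw [Complex.exp_neg, eta, tan_half_sub_I hθ₁, tan_half_sub_I hθ₂,
      Complex.exp_log (div_ne_zero (hne hθ₂) (hne hθ₁)), inv_div]
  have h2 : NormedSpace.exp (pencilY A E θ₁ θ₂) = Complex.exp (-eta θ₁ θ₂) •
      (gammaC A E (Real.tan (θ₂ / 2)) * (gammaC A E (Real.tan (θ₁ / 2)))⁻¹) := by
    rw [pencilY, matrixLog_eq_logIntegral hsp, ← neg_smul,
      matrix_exp_add ((Commute.one_left _).smul_left _), matrix_exp_smul_one,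
      exp_logIntegral hsp, smul_mul_assoc, one_mul]
  have h3 : pencilC A E θ₁ = (gammaFactor θ₁)⁻¹ • gammaC A E (Real.tan (θ₁ / 2)) := by
    rw [gammaC_tan_half A E hθ₁, smul_smul, inv_mul_cancel₀ (gammaFactor_ne_zero hθ₁), one_smul]
  rw [h2, h3, smul_mul_smul_comm, mul_assoc, matrix_inv_mul (hG _ Set.left_mem_uIcc), mul_one,
    gammaC_tan_half A E hθ₂, smul_smul, h1, Complex.exp_sub]
  congr 1
  have := gammaFactor_ne_zero hθ₁
  have := gammaFactor_ne_zero hθ₂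
  have := Complex.exp_ne_zero (Complex.I * θ₂)
  field_simp

theorem exp_pencilY_sub_one_mul (hθ₁ : θ₁ ∈ Set.Ioo (-Real.pi) Real.pi)
    (hθ₂ : θ₂ ∈ Set.Ioo (-Real.pi) Real.pi)
    (hR : ∀ θ ∈ Set.uIcc θ₁ θ₂, IsUnit (pencilC A E θ)) :
    (NormedSpace.exp (pencilY A E θ₁ θ₂) - 1) * pencilC A E θ₁ =
      (1 - Complex.exp (Complex.I * θ₁ - Complex.I * θ₂)) • A := by
  rw [sub_mul, exp_pencilY_mul hθ₁ hθ₂ hR, one_mul, pencilC, pencilC, smul_sub, smul_smul,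
    ← Complex.exp_add, sub_add_cancel]
  module

theorem exp_smul_one_sub_mul (hθ₁ : θ₁ ∈ Set.Ioo (-Real.pi) Real.pi)
    (hθ₂ : θ₂ ∈ Set.Ioo (-Real.pi) Real.pi)
    (hR : ∀ θ ∈ Set.uIcc θ₁ θ₂, IsUnit (pencilC A E θ)) :
    (Complex.exp (-(Complex.I * θ₂)) • (1 : Matrix (Fin n) (Fin n) ℂ) -
        Complex.exp (-(Complex.I * θ₁)) • NormedSpace.exp (pencilY A E θ₁ θ₂)) *
      pencilC A E θ₁ =
      -((1 - Complex.exp (Complex.I * θ₁ - Complex.I * θ₂)) • E) := by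
  rw [sub_mul, smul_mul_assoc _ (NormedSpace.exp _), exp_pencilY_mul hθ₁ hθ₂ hR, smul_mul_assoc,
    one_mul, pencilC, pencilC, smul_smul, ← Complex.exp_add, smul_sub, smul_sub, smul_smul,
    smul_smul, ← Complex.exp_add, ← Complex.exp_add,
    show -(Complex.I * (θ₁ : ℂ)) + (Complex.I * θ₁ - Complex.I * θ₂) = -(Complex.I * θ₂) by ring,
    neg_add_cancel, Complex.exp_zero, neg_add_eq_sub]
  module

/-- An eigenvalue of Y is one of log M minus η. The first has imaginary part in (-π, π), the second
in (-π, π], so both bounds are strict. -/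
theorem im_spectrum_pencilY (hθ₁ : θ₁ ∈ Set.Ioo (-Real.pi) Real.pi)
    (hθ₂ : θ₂ ∈ Set.Ioo (-Real.pi) Real.pi)
    (hR : ∀ θ ∈ Set.uIcc θ₁ θ₂, IsUnit (pencilC A E θ)) :
    ∀ z ∈ spectrum ℂ (pencilY A E θ₁ θ₂), -(2 * Real.pi) < z.im ∧ z.im < 2 * Real.pi := by
  have hsp := spectrum_gammaC_quot fun t ht => isUnit_gammaC hθ₁ hθ₂ hR ht
  intro z hz
  rw [pencilY, matrixLog_eq_logIntegral hsp] at hz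
  obtain ⟨v, hv, h1, -⟩ := exists_eigenvector_of_mem_spectrum (Commute.one_right _) hz
  rw [Matrix.add_mulVec, Matrix.neg_mulVec, Matrix.smul_mulVec, Matrix.one_mulVec,
    neg_add_eq_sub, sub_eq_iff_eq_add, ← add_smul] at h1
  have h2 := (isPrincipalLog_logIntegral hsp).2 _ (mem_spectrum_of_mulVec_eq hv h1)
  have h3 := Complex.neg_pi_lt_log_im (((Real.tan (θ₂ / 2) : ℂ) - Complex.I) /
    ((Real.tan (θ₁ / 2) : ℂ) - Complex.I))
  have h4 := Complex.log_im_le_pi (((Real.tan (θ₂ / 2) : ℂ) - Complex.I) /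
    ((Real.tan (θ₁ / 2) : ℂ) - Complex.I))
  rw [Complex.add_im, eta] at h2
  constructor <;> linarith [h2.1, h2.2]

theorem isUnit_psi1_pencilY (hθ₁ : θ₁ ∈ Set.Ioo (-Real.pi) Real.pi)
    (hθ₂ : θ₂ ∈ Set.Ioo (-Real.pi) Real.pi)
    (hR : ∀ θ ∈ Set.uIcc θ₁ θ₂, IsUnit (pencilC A E θ)) :
    IsUnit (psi1 (pencilY A E θ₁ θ₂)) :=
  isUnit_psi1 (im_spectrum_pencilY hθ₁ hθ₂ hR)

/-- The identity `ψ₁(Y) · j E ∫ (e^{jθ} E - A)⁻¹ dθ = e^{-jθ₁} e^Y - e^{-jθ₂}` for invertible `A`. -/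
theorem psi1_pencilY_mul_of_isUnit (hθ₁ : θ₁ ∈ Set.Ioo (-Real.pi) Real.pi)
    (hθ₂ : θ₂ ∈ Set.Ioo (-Real.pi) Real.pi)
    (hR : ∀ θ ∈ Set.uIcc θ₁ θ₂, IsUnit (pencilC A E θ)) (hA : IsUnit A) :
    psi1 (pencilY A E θ₁ θ₂) * (Complex.I • (E * pencilJ A E θ₁ θ₂)) =
      -(Complex.exp (-(Complex.I * θ₂)) • (1 : Matrix (Fin n) (Fin n) ℂ) -
        Complex.exp (-(Complex.I * θ₁)) • NormedSpace.exp (pencilY A E θ₁ θ₂)) := by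
  set Y := pencilY A E θ₁ θ₂ with hY
  have hYJ : Y = _ := pencilY_eq hθ₁ hθ₂ hR
  have hc := continuousOn_pencilC_inv hR
  have hEJ : Complex.I • (E * pencilJ A E θ₁ θ₂) = E * A⁻¹ * Y := by
    rw [hYJ, mul_smul_comm, mul_assoc E, ← mul_assoc A⁻¹, matrix_inv_mul hA, one_mul]
  have hcomm : Commute (E * A⁻¹) Y := by
    rw [hYJ, pencilJ, ← integral_matrix_const_mul _ hc]
    refine Commute.smul_right (commute_intervalIntegral (continuousOn_const.mul hc)
      fun θ hθ => ?_) _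
    -- The matrix inverted on the right is e^{jθ}EA⁻¹ - 1, which commutes with EA⁻¹.
    have h1 : A * (pencilC A E θ)⁻¹ = (pencilC A E θ * A⁻¹)⁻¹ := by
      rw [Matrix.mul_inv_rev,
        Matrix.nonsing_inv_nonsing_inv _ ((Matrix.isUnit_iff_isUnit_det _).mp hA)]
    change Commute _ (A * (pencilC A E θ)⁻¹)
    rw [h1]
    refine commute_inv ?_
    rw [pencilC, sub_mul, smul_mul_assoc, matrix_mul_inv hA]
    exact ((Commute.refl _).smul_right _).sub_right (Commute.one_right _)
  have hu := hR θ₁ Set.left_mem_uIcc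
  -- After right multiplication by R(θ₁), both sides become the same multiple of E.
  refine hu.mul_left_injective ?_
  dsimp only
  rw [neg_mul, exp_smul_one_sub_mul hθ₁ hθ₂ hR, neg_neg, hEJ, ← mul_assoc,
    ← (commute_psi1 hcomm).eq, mul_assoc (E * A⁻¹), psi1_mul_self, mul_assoc (E * A⁻¹), hY,
    exp_pencilY_sub_one_mul hθ₁ hθ₂ hR, mul_smul_comm, mul_assoc, matrix_inv_mul hA, mul_one]

end PencilIntegral

/-! ### The perturbed pencil: invertibility and continuity at ε = 0. -/

section Perturbation

open scoped Matrix.Norms.Operator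

variable {n : ℕ} {A E : Matrix (Fin n) (Fin n) ℝ} {θ₁ θ₂ : ℝ} (α β : ℂ)

@[simp]
theorem perturbA_zero (A : Matrix (Fin n) (Fin n) ℝ) : perturbA A α 0 = toComplex A := by
  simp [perturbA]

@[simp]
theorem perturbE_zero (E : Matrix (Fin n) (Fin n) ℝ) : perturbE E β 0 = toComplex E := by
  simp [perturbE]

theorem continuous_perturbA (A : Matrix (Fin n) (Fin n) ℝ) : Continuous (perturbA A α) := by
  unfold perturbA
  fun_prop

theorem continuous_perturbE (E : Matrix (Fin n) (Fin n) ℝ) : Continuous (perturbE E β) := by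
  unfold perturbE
  fun_prop

theorem matrixY_eq_pencilY (A E : Matrix (Fin n) (Fin n) ℝ) (θ₁ θ₂ : ℝ) (ε : ℂ) :
    matrixY A E α β θ₁ θ₂ ε = pencilY (perturbA A α ε) (perturbE E β ε) θ₁ θ₂ := rfl

theorem continuous_pencilC_perturb (A E : Matrix (Fin n) (Fin n) ℝ) :
    Continuous fun p : ℂ × ℝ => pencilC (perturbA A α p.1) (perturbE E β p.1) p.2 := by
  unfold pencilC perturbA perturbE
  fun_prop

/-- The determinant is jointly continuous in (ε, θ), and compactness of the θ-interval makes the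
neighbourhood of 0 uniform. -/
theorem eventually_isUnit_pencilC
    (hR : ∀ θ ∈ Set.uIcc θ₁ θ₂, IsUnit (pencilC (toComplex A) (toComplex E) θ)) :
    ∀ᶠ ε : ℂ in 𝓝 0, ∀ θ ∈ Set.uIcc θ₁ θ₂,
      IsUnit (pencilC (perturbA A α ε) (perturbE E β ε) θ) := by
  refine isCompact_uIcc.eventually_forall_of_forall_eventually fun θ hθ => ?_
  have h := (continuous_pencilC_perturb α β A E).matrix_det.continuousAt (x := ((0 : ℂ), θ))
  have h0 := (Matrix.isUnit_iff_isUnit_det _).mp (hR θ hθ)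
  have h1 := h.eventually_ne (y := 0) (by simpa using h0)
  filter_upwards [h1] with p hp
  exact (Matrix.isUnit_iff_isUnit_det _).mpr (isUnit_iff_ne_zero.mpr hp)

theorem continuousAt_pencilJ_perturb
    (hR : ∀ θ ∈ Set.uIcc θ₁ θ₂, IsUnit (pencilC (toComplex A) (toComplex E) θ)) :
    ContinuousAt (fun ε : ℂ => pencilJ (perturbA A α ε) (perturbE E β ε) θ₁ θ₂) 0 :=
  continuousAt_intervalIntegral (eventually_isUnit_pencilC α β hR)
    (continuousOn_matrix_inv (continuous_pencilC_perturb α β A E).continuousOn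
      fun p hp => hp.1 p.2 hp.2)

theorem continuousAt_matrixY (hθ₁ : θ₁ ∈ Set.Ioo (-Real.pi) Real.pi)
    (hθ₂ : θ₂ ∈ Set.Ioo (-Real.pi) Real.pi)
    (hR : ∀ θ ∈ Set.uIcc θ₁ θ₂, IsUnit (pencilC (toComplex A) (toComplex E) θ)) :
    ContinuousAt (fun ε : ℂ => matrixY A E α β θ₁ θ₂ ε) 0 := by
  have h : ContinuousAt (fun ε : ℂ => Complex.I •
      (perturbA A α ε * pencilJ (perturbA A α ε) (perturbE E β ε) θ₁ θ₂)) 0 :=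
    ((continuous_perturbA α A).continuousAt.mul
      (continuousAt_pencilJ_perturb α β hR)).const_smul Complex.I
  refine h.congr ?_
  filter_upwards [eventually_isUnit_pencilC α β hR] with ε hε
  exact (pencilY_eq hθ₁ hθ₂ hε).symm

theorem eventually_isUnit_perturbA (hW : IsUnit (pencilW A E α β)) :
    ∀ᶠ ε : ℂ in 𝓝[≠] 0, IsUnit (perturbA A α ε) := by
  rcases eq_or_ne α 0 with rfl | hα
  · refine Eventually.of_forall fun ε => ?_
    have hA : IsUnit (β • toComplex A) := by simpa [pencilW] using hW
    have h0 : perturbA A 0 ε = toComplex A := by simp [perturbA]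
    rw [h0, Matrix.isUnit_iff_isUnit_det]
    rw [Matrix.isUnit_iff_isUnit_det, Matrix.det_smul] at hA
    exact isUnit_of_mul_isUnit_right hA
  -- The bad values of ε are finitely many. Zero, bad when A is singular, is removed so that the
  -- rest stay away from it.
  · have hfin : ((α * ·) ⁻¹' spectrum ℂ (-toComplex A) \ {0}).Finite :=
      ((Matrix.finite_spectrum (-toComplex A)).preimage
        (mul_right_injective₀ hα).injOn).subset Set.sdiff_subset
    have h1 := hfin.isClosed.isOpen_compl.mem_nhds (x := (0 : ℂ)) (by simp)
    filter_upwards [mem_nhdsWithin_of_mem_nhds h1, self_mem_nhdsWithin] with ε hε hε0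
    have h2 : α * ε ∉ spectrum ℂ (-toComplex A) := fun h => hε ⟨h, hε0⟩
    rw [spectrum.notMem_iff, sub_neg_eq_add, Algebra.algebraMap_eq_smul_one, add_comm] at h2
    exact h2

theorem wrap_eq_self {θ : ℝ} (hθ : θ ∈ Set.Ioo (-Real.pi) Real.pi) : wrap θ = θ := by
  rw [wrap, ← Complex.log_im, Complex.log_exp (by simpa using hθ.1) (by simpa using hθ.2.le)]
  simp

theorem isUnit_pencilAt_of_not_eigenvalue {θ : ℝ}
    (h : ¬ IsPencilEigenvalue A E (Complex.exp (Complex.I * (θ : ℂ)))) :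
    IsUnit (pencilAt A E θ) := by
  rw [IsPencilEigenvalue, ← ne_eq, ← isUnit_iff_ne_zero, ← Matrix.isUnit_iff_isUnit_det] at h
  rw [pencilAt, ← neg_sub]
  exact h.neg

theorem intervalIntegrable_entry {F : ℝ → Matrix (Fin n) (Fin n) ℂ} {a b : ℝ}
    (hF : ContinuousOn F (Set.uIcc a b)) (i k : Fin n) :
    IntervalIntegrable (fun θ => F θ i k) MeasureTheory.volume a b := by
  refine ContinuousOn.intervalIntegrable ?_
  exact (continuous_id.matrix_elem i k).comp_continuousOn hF

theorem matrixIntegral_eq {F : ℝ → Matrix (Fin n) (Fin n) ℂ} {a b : ℝ}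
    (hF : ContinuousOn F (Set.uIcc a b)) : matrixIntegral F a b = ∫ θ in a..b, F θ := by
  ext i k
  exact map_intervalIntegral
    (LinearMap.toContinuousLinearMap (Matrix.entryLinearMap ℂ ℂ i k)) hF

theorem continuousAt_matrix_inv_comp {F : ℂ → Matrix (Fin n) (Fin n) ℂ} {x : ℂ}
    (hF : ContinuousAt F x) (hu : IsUnit (F x)) : ContinuousAt (fun ε => (F ε)⁻¹) x := by
  obtain ⟨u, hfu⟩ := hu
  have h := NormedRing.inverse_continuousAt u
  simp only [Matrix.nonsing_inv_eq_ringInverse]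
  rw [hfu] at h
  exact ContinuousAt.comp (g := Ring.inverse) h hF

end Perturbation

/-! ### Passing to singular A. -/

section Limit

variable {n : ℕ} {A E : Matrix (Fin n) (Fin n) ℝ} {θ₁ θ₂ : ℝ} (α β : ℂ)

/-- Both sides are continuous in ε at 0 and agree for small ε ≠ 0, where A_ε is invertible. -/
theorem psi1_matrixY_mul (hθ₁ : θ₁ ∈ Set.Ioo (-Real.pi) Real.pi)
    (hθ₂ : θ₂ ∈ Set.Ioo (-Real.pi) Real.pi) (hW : IsUnit (pencilW A E α β))
    (hR : ∀ θ ∈ Set.uIcc θ₁ θ₂, IsUnit (pencilC (toComplex A) (toComplex E) θ)) :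
    psi1 (matrixY A E α β θ₁ θ₂ 0) *
        (Complex.I • (toComplex E * pencilJ (toComplex A) (toComplex E) θ₁ θ₂)) =
      -(Complex.exp (-(Complex.I * θ₂)) • (1 : Matrix (Fin n) (Fin n) ℂ) -
        Complex.exp (-(Complex.I * θ₁)) • NormedSpace.exp (matrixY A E α β θ₁ θ₂ 0)) := by
  have hY := continuousAt_matrixY α β hθ₁ hθ₂ hR
  have h1 : ContinuousAt (fun ε : ℂ => psi1 (matrixY A E α β θ₁ θ₂ ε) *
      (Complex.I • (perturbE E β ε * pencilJ (perturbA A α ε) (perturbE E β ε) θ₁ θ₂))) 0 :=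
    (continuous_psi1.continuousAt.comp hY).mul (((continuous_perturbE β E).continuousAt.mul
      (continuousAt_pencilJ_perturb α β hR)).const_smul Complex.I)
  have hexp : ContinuousAt (fun ε : ℂ => NormedSpace.exp (matrixY A E α β θ₁ θ₂ ε)) 0 :=
    continuous_matrix_exp.continuousAt.comp hY
  have h2 : ContinuousAt (fun ε : ℂ =>
      -(Complex.exp (-(Complex.I * θ₂)) • (1 : Matrix (Fin n) (Fin n) ℂ) -
        Complex.exp (-(Complex.I * θ₁)) • NormedSpace.exp (matrixY A E α β θ₁ θ₂ ε))) 0 :=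
    (continuousAt_const.sub (hexp.const_smul (Complex.exp (-(Complex.I * θ₁))))).neg
  have h3 := tendsto_nhds_unique_of_eventuallyEq (h1.tendsto.mono_left nhdsWithin_le_nhds)
    (h2.tendsto.mono_left (nhdsWithin_le_nhds (s := {0}ᶜ))) (by
      filter_upwards [eventually_isUnit_perturbA α β hW,
        mem_nhdsWithin_of_mem_nhds (eventually_isUnit_pencilC α β hR)] with ε hA hε
      exact psi1_pencilY_mul_of_isUnit hθ₁ hθ₂ hε hA)
  simpa only [perturbA_zero, perturbE_zero] using h3

end Limit

/-! ### Invertibility of e^Y - I, the closed form, and the main theorem. -/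

theorem isUnit_exp_pencilY_sub_one {n : ℕ} {A E : Matrix (Fin n) (Fin n) ℂ} {θ₁ θ₂ : ℝ}
    (hθ₁ : θ₁ ∈ Set.Ioo (-Real.pi) Real.pi) (hθ₂ : θ₂ ∈ Set.Ioo (-Real.pi) Real.pi)
    (hne : θ₁ ≠ θ₂) (hR : ∀ θ ∈ Set.uIcc θ₁ θ₂, IsUnit (pencilC A E θ)) (hA : IsUnit A) :
    IsUnit (NormedSpace.exp (pencilY A E θ₁ θ₂) - 1) := by
  -- Here (e^Y - I)R(θ₁) is this scalar times A; it vanishes only if e^{jθ₁} = e^{jθ₂}, which forces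
  -- equal angles in (-π, π).
  have hc : 1 - Complex.exp (Complex.I * θ₁ - Complex.I * θ₂) ≠ 0 := by
    intro h
    have h1 : Complex.exp (Complex.I * θ₁) = Complex.exp (Complex.I * θ₂) := by
      rw [Complex.exp_sub, sub_eq_zero, eq_comm, div_eq_one_iff_eq (Complex.exp_ne_zero _)] at h
      exact h
    apply hne
    rw [← wrap_eq_self hθ₁, ← wrap_eq_self hθ₂, wrap, wrap, h1]
  have h := isUnit_smul_matrix hc hA
  rw [← exp_pencilY_sub_one_mul hθ₁ hθ₂ hR] at h
  rw [Matrix.isUnit_iff_isUnit_det, Matrix.det_mul] at h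
  exact (Matrix.isUnit_iff_isUnit_det _).mpr (isUnit_of_mul_isUnit_left h)

/-- The formulas for jAJ and jEJ combine to jWJ, and W is then cancelled. -/
theorem pencilJ_eq {n : ℕ} {A E : Matrix (Fin n) (Fin n) ℝ} {α β : ℂ} {θ₁ θ₂ : ℝ}
    (hθ₁ : θ₁ ∈ Set.Ioo (-Real.pi) Real.pi) (hθ₂ : θ₂ ∈ Set.Ioo (-Real.pi) Real.pi)
    (hW : IsUnit (pencilW A E α β))
    (hR : ∀ θ ∈ Set.uIcc θ₁ θ₂, IsUnit (pencilC (toComplex A) (toComplex E) θ)) :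
    pencilJ (toComplex A) (toComplex E) θ₁ θ₂ =
      (1 / Complex.I) • ((pencilW A E α β)⁻¹ *
        (-(α • ((psi1 (matrixY A E α β θ₁ θ₂ 0))⁻¹ *
            (Complex.exp (-(Complex.I * (θ₂ : ℂ))) • (1 : Matrix (Fin n) (Fin n) ℂ) -
              Complex.exp (-(Complex.I * (θ₁ : ℂ))) •
                NormedSpace.exp (matrixY A E α β θ₁ θ₂ 0)))) +
          β • matrixY A E α β θ₁ θ₂ 0)) := by
  have hY : matrixY A E α β θ₁ θ₂ 0 = pencilY (toComplex A) (toComplex E) θ₁ θ₂ := by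
    rw [matrixY_eq_pencilY, perturbA_zero, perturbE_zero]
  have hu : IsUnit (psi1 (matrixY A E α β θ₁ θ₂ 0)) := by
    rw [hY]; exact isUnit_psi1_pencilY hθ₁ hθ₂ hR
  have h1 := psi1_matrixY_mul α β hθ₁ hθ₂ hW hR
  rw [← neg_eq_iff_eq_neg] at h1
  rw [← h1, mul_neg, ← mul_assoc, matrix_inv_mul hu, one_mul, hY, pencilY_eq hθ₁ hθ₂ hR]
  set J := pencilJ (toComplex A) (toComplex E) θ₁ θ₂
  have h2 : -(α • -(Complex.I • (toComplex E * J))) + β • Complex.I • (toComplex A * J) =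
      Complex.I • (pencilW A E α β * J) := by
    rw [pencilW, add_mul, smul_mul_assoc, smul_mul_assoc]
    module
  rw [h2, mul_smul_comm, smul_smul, one_div, inv_mul_cancel₀ Complex.I_ne_zero, one_smul,
    ← mul_assoc, matrix_inv_mul hW, one_mul]

end DescriptorIntegral

end

theorem mainTheorem4 {n : ℕ} (A E : Matrix (Fin n) (Fin n) ℝ) (α β : ℂ) (θ₁ θ₂ : ℝ)
    (hθ₁ : θ₁ ∈ Set.Ioo (-Real.pi) Real.pi) (hθ₂ : θ₂ ∈ Set.Ioo (-Real.pi) Real.pi)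
    (hW : IsUnit (DescriptorIntegral.pencilW A E α β))
    (hspec : ∀ φ : ℝ, DescriptorIntegral.wrap φ ∈ Set.uIcc θ₁ θ₂ →
      ¬ DescriptorIntegral.IsPencilEigenvalue A E (Complex.exp (Complex.I * (φ : ℂ)))) :
    -- the logarithm defining `Y` exists
    IsUnit (DescriptorIntegral.pencilGamma A E α β θ₁ 0) ∧
    DescriptorIntegral.HasPrincipalLog (DescriptorIntegral.gammaQuot A E α β θ₁ θ₂ 0) ∧
    -- the logarithm defining `Y_ε` exists for all small `ε`, and `Y_ε → Y`
    (∀ᶠ ε : ℂ in 𝓝[≠] 0, IsUnit (DescriptorIntegral.pencilGamma A E α β θ₁ ε) ∧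
      DescriptorIntegral.HasPrincipalLog (DescriptorIntegral.gammaQuot A E α β θ₁ θ₂ ε)) ∧
    Tendsto (fun ε : ℂ => DescriptorIntegral.matrixY A E α β θ₁ θ₂ ε) (𝓝[≠] 0)
      (𝓝 (DescriptorIntegral.matrixY A E α β θ₁ θ₂ 0)) ∧
    -- `ψ₁(Y)` is invertible, and `(e^{Y_ε} - I)⁻¹ Y_ε → ψ₁(Y)⁻¹` if the interval is nondegenerate
    IsUnit (DescriptorIntegral.psi1 (DescriptorIntegral.matrixY A E α β θ₁ θ₂ 0)) ∧
    (θ₁ ≠ θ₂ →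
      (∀ᶠ ε : ℂ in 𝓝[≠] 0,
        IsUnit (NormedSpace.exp (DescriptorIntegral.matrixY A E α β θ₁ θ₂ ε) - 1)) ∧
      Tendsto
        (fun ε : ℂ =>
          (NormedSpace.exp (DescriptorIntegral.matrixY A E α β θ₁ θ₂ ε) - 1)⁻¹ *
            DescriptorIntegral.matrixY A E α β θ₁ θ₂ ε)
        (𝓝[≠] 0)
        (𝓝 (DescriptorIntegral.psi1 (DescriptorIntegral.matrixY A E α β θ₁ θ₂ 0))⁻¹)) ∧
    -- the integrand exists and is integrable, and the integral has the closed form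
    (∀ θ ∈ Set.uIcc θ₁ θ₂, IsUnit (DescriptorIntegral.pencilAt A E θ)) ∧
    (∀ i k : Fin n, IntervalIntegrable
      (fun θ : ℝ => (DescriptorIntegral.pencilAt A E θ)⁻¹ i k) MeasureTheory.volume θ₁ θ₂) ∧
    DescriptorIntegral.matrixIntegral
        (fun θ : ℝ => (DescriptorIntegral.pencilAt A E θ)⁻¹) θ₁ θ₂ =
      (1 / Complex.I) • ((DescriptorIntegral.pencilW A E α β)⁻¹ *
        (-(α • ((DescriptorIntegral.psi1 (DescriptorIntegral.matrixY A E α β θ₁ θ₂ 0))⁻¹ *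
            (Complex.exp (-(Complex.I * (θ₂ : ℂ))) • (1 : Matrix (Fin n) (Fin n) ℂ) -
              Complex.exp (-(Complex.I * (θ₁ : ℂ))) •
                NormedSpace.exp (DescriptorIntegral.matrixY A E α β θ₁ θ₂ 0)))) +
          β • DescriptorIntegral.matrixY A E α β θ₁ θ₂ 0)) := by
  have hA : ∀ θ ∈ Set.uIcc θ₁ θ₂, IsUnit (DescriptorIntegral.pencilAt A E θ) := fun θ hθ =>
    DescriptorIntegral.isUnit_pencilAt_of_not_eigenvalue (hspec θ (by
      rwa [DescriptorIntegral.wrap_eq_self (DescriptorIntegral.mem_Ioo_of_mem_uIcc hθ₁ hθ₂ hθ)]))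
  have hR : ∀ θ ∈ Set.uIcc θ₁ θ₂, IsUnit (DescriptorIntegral.pencilC
      (DescriptorIntegral.toComplex A) (DescriptorIntegral.toComplex E) θ) := hA
  have hev := DescriptorIntegral.eventually_isUnit_pencilC α β hR
  have hgood : ∀ ε : ℂ, (∀ θ ∈ Set.uIcc θ₁ θ₂, IsUnit (DescriptorIntegral.pencilC
      (DescriptorIntegral.perturbA A α ε) (DescriptorIntegral.perturbE E β ε) θ)) →
      IsUnit (DescriptorIntegral.pencilGamma A E α β θ₁ ε) ∧
        DescriptorIntegral.HasPrincipalLog (DescriptorIntegral.gammaQuot A E α β θ₁ θ₂ ε) :=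
    fun ε hε => ⟨DescriptorIntegral.isUnit_gammaC_tan_half hθ₁ (hε _ Set.left_mem_uIcc),
      DescriptorIntegral.hasPrincipalLog_of_spectrum (DescriptorIntegral.spectrum_gammaC_quot
        fun t ht => DescriptorIntegral.isUnit_gammaC hθ₁ hθ₂ hε ht)⟩
  have hY := DescriptorIntegral.continuousAt_matrixY α β hθ₁ hθ₂ hR
  have hpsi : IsUnit (DescriptorIntegral.psi1 (DescriptorIntegral.matrixY A E α β θ₁ θ₂ 0)) :=
    DescriptorIntegral.isUnit_psi1_pencilY hθ₁ hθ₂ hev.self_of_nhds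
  have hexp : θ₁ ≠ θ₂ → ∀ᶠ ε : ℂ in 𝓝[≠] 0,
      IsUnit (NormedSpace.exp (DescriptorIntegral.matrixY A E α β θ₁ θ₂ ε) - 1) := fun hne => by
    filter_upwards [mem_nhdsWithin_of_mem_nhds hev,
      DescriptorIntegral.eventually_isUnit_perturbA α β hW] with ε hε hAε
    exact DescriptorIntegral.isUnit_exp_pencilY_sub_one hθ₁ hθ₂ hne hε hAε
  refine ⟨(hgood 0 hev.self_of_nhds).1, (hgood 0 hev.self_of_nhds).2,
    mem_nhdsWithin_of_mem_nhds (hev.mono hgood), hY.tendsto.mono_left nhdsWithin_le_nhds, hpsi,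
    fun hne => ⟨hexp hne, ?_⟩, hA,
    DescriptorIntegral.intervalIntegrable_entry (DescriptorIntegral.continuousOn_pencilC_inv hR),
    ?_⟩
  · have h1 : ContinuousAt (fun ε : ℂ =>
        DescriptorIntegral.psi1 (DescriptorIntegral.matrixY A E α β θ₁ θ₂ ε)) 0 :=
      DescriptorIntegral.continuous_psi1.continuousAt.comp hY
    refine ((DescriptorIntegral.continuousAt_matrix_inv_comp h1 hpsi).tendsto.mono_left
      nhdsWithin_le_nhds).congr' ?_
    -- Where e^{Y_ε} - I is invertible, ψ₁(Y_ε)Y_ε = e^{Y_ε} - I identifies the quotient with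
    -- ψ₁(Y_ε)⁻¹, whose limit is already known.
    filter_upwards [hexp hne] with ε hε
    refine Matrix.inv_eq_right_inv ?_
    have h2 : Commute (DescriptorIntegral.matrixY A E α β θ₁ θ₂ ε)
        (NormedSpace.exp (DescriptorIntegral.matrixY A E α β θ₁ θ₂ ε) - 1)⁻¹ :=
      DescriptorIntegral.commute_inv
        ((Commute.refl _).exp_right.sub_right (Commute.one_right _))
    rw [← h2.eq, ← mul_assoc, DescriptorIntegral.psi1_mul_self,
      DescriptorIntegral.matrix_mul_inv hε]
  · exact (DescriptorIntegral.matrixIntegral_eq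
      (DescriptorIntegral.continuousOn_pencilC_inv hR)).trans
      (DescriptorIntegral.pencilJ_eq hθ₁ hθ₂ hW hR)
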